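/- **Setting.** Fix $T>0$ and a probability space $(\Omega,\mathcal F,P)$. A centered Gaussian process $X=(X_t)_{t\in[0,T]}$ is always assumed to satisfy $X_0=0$ almost surely. Its space of deterministic integrands $\mathfrak H_X$ is the Hilbert space obtained as the closure (completion) of the linear span of the indicator functions $\mathbf 1_{(0,t]}$, $t\in[0,T]$, under the inner product $\langle \mathbf 1_{(0,t]},\mathbf 1_{(0,s]}\rangle_{\mathfrak H_X}=E[X_tX_s]$. The Wiener integral $I:\mathfrak H_X\to L^2(P)$ is the linear isometry extending $\mathbf 1_{(0,t]}\mapsto X_t$. We say that $X$ *has an indefinite Wiener integral* if for every $r\in[0,T]$ there is a continuous linear operator $\mathcal I_r:\mathfrak H_X\to\mathfrak H_X$ with $\mathcal I_r(\mathbf 1_{(0,t]})=\mathbf 1_{(0,t\wedge r]}$ for all $t\in[0,T]$. Fractional Brownian motion $B^H$ with Hurst parameter $H\in(0,1)$ is a centered Gaussian process with $E[B^H_tB^H_s]=\frac12\left(t^{2H}+s^{2H}-|t-s|^{2H}\right)$. For $H>\frac12$ and measurable $f:[0,T]\to\mathbb R$, the fractional Wiener integral $\int_0^T f(s)\,dB^H_s$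 is $I(\mathfrak h)$, where $\mathfrak h=\lim_n\varphi_n$ in $\mathfrak H_{B^H}$ for a sequence of step functions $\varphi_n$ (linear combinations of the $\mathbf 1_{(0,t]}$, $t\in[0,T]$) such that $\int_0^T\!\int_0^T|\varphi_n-f|(s)\,|\varphi_n-f|(u)\,|s-u|^{2H-2}\,du\,ds\to0$; and $\int_0^t f\,dB^H:=\int_0^T\mathbf 1_{(0,t]}f\,dB^H$. **Theorem.** (i) Fractional Brownian motion $B^H$ with any Hurst parameter $H\in(0,1)$ has an indefinite Wiener integral. (ii) Let $B^H$ be a fractional Brownian motion with $H\in(\frac12,1)$, and let $\sigma$ be a deterministic measurable function on $[0,T]$ with $\epsilon\le\sigma\le\epsilon^{-1}$ for some $\epsilon\in(0,1)$. Then the fractional Wiener integral $X_t=\int_0^t\sigma(s)\,dB^H_s$ exists for every $t\in[0,T]$, and the process $X$ (for any choice of versions of the $X_t$) is a centered Gaussian process which has an indefinite Wiener integral. (iii) Let $X^{(1)},X^{(2)}$ be independent centered Gaussian processes on $(\Omega,\mathcal F,P)$, let $\gamma\neq0$ be a constant, and let $X_t=X^{(1)}_t+\gamma X^{(2)}_t$.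 If $X^{(1)}$ and $X^{(2)}$ have indefinite Wiener integrals, then $X$ is a centered Gaussian process which has an indefinite Wiener integral. -/

import Mathlib

open MeasureTheory ProbabilityTheory Filter Topology Set
open scoped ENNReal

noncomputable section

namespace WienerInt

/-- `X = (X_t)_{0 ≤ t ≤ T}` is a centered Gaussian process on `(Ω, P)` with `X_0 = 0`
almost surely. -/
structure IsCenteredGaussian {Ω : Type*} [MeasurableSpace Ω] {T : ℝ}
    (X : Icc (0 : ℝ) T → Ω → ℝ) (P : Measure Ω) : Prop where
  gaussian : IsGaussianProcess X P
  centered : ∀ t, ∫ ω, X t ω ∂P = 0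
  start : ∀ t : Icc (0 : ℝ) T, (t : ℝ) = 0 → X t =ᵐ[P] 0

/-- `B` is a fractional Brownian motion on `[0, T]` with Hurst parameter `H`. -/
structure IsFractionalBrownianMotion {Ω : Type*} [MeasurableSpace Ω] {T : ℝ} (H : ℝ)
    (B : Icc (0 : ℝ) T → Ω → ℝ) (P : Measure Ω) : Prop extends IsCenteredGaussian B P where
  covariance : ∀ t s : Icc (0 : ℝ) T, ∫ ω, B t ω * B s ω ∂P =
    1 / 2 * ((t : ℝ) ^ (2 * H) + (s : ℝ) ^ (2 * H) - |(t : ℝ) - (s : ℝ)| ^ (2 * H))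

theorem IsCenteredGaussian.memLp {Ω : Type*} [MeasurableSpace Ω] {T : ℝ}
    {X : Icc (0 : ℝ) T → Ω → ℝ} {P : Measure Ω} (hX : IsCenteredGaussian X P)
    (t : Icc (0 : ℝ) T) : MemLp (X t) 2 P :=
  (hX.gaussian.hasGaussianLaw_eval t).memLp_two

/-! ### Step functions -/

/-- The function `1_{(0,t]}` on the real line. -/
def ind (t : ℝ) : ℝ → ℝ := (Ioc 0 t).indicator 1

theorem ind_of_eq_zero {t : ℝ} (ht : t = 0) : ind t = 0 := by
  rw [ind, ht, Ioc_self, indicator_empty']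

/-- The indicator functions `1_{(0,t]}` with `0 < t ≤ T`. -/
def indFamily (T : ℝ) : Ioc (0 : ℝ) T → ℝ → ℝ := fun t => ind t

theorem linearIndependent_indFamily (T : ℝ) : LinearIndependent ℝ (indFamily T) := by
  rw [linearIndependent_iff']
  intro s c hc
  by_contra! hne
  obtain ⟨i, his, hi⟩ := hne
  have hS : (s.filter fun j => c j ≠ 0).Nonempty := ⟨i, by simp [his, hi]⟩
  obtain ⟨m, hm, hmax⟩ := Finset.exists_max_image (s.filter fun j => c j ≠ 0) id hS
  simp only [Finset.mem_filter, id] at hm hmax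
  have h := congrFun hc (m : ℝ)
  rw [Finset.sum_apply, Finset.sum_eq_single m] at h
  · have hmm : indFamily T m (m : ℝ) = 1 := by simp [indFamily, ind, m.2.1]
    rw [Pi.smul_apply, hmm] at h
    exact hm.2 (by simpa using h)
  · intro j hj hjm
    by_cases hcj : c j = 0
    · simp [hcj]
    · have hlt : (j : ℝ) < m := lt_of_le_of_ne (hmax j ⟨hj, hcj⟩) (fun h => hjm (Subtype.ext h))
      have hz : indFamily T j (m : ℝ) = 0 :=
        indicator_of_notMem (fun h => absurd h.2 (not_le.2 hlt)) _
      simp [hz]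
  · exact fun h => absurd hm.1 h

/-- The space of step functions: the linear span of the functions `1_{(0,t]}`, `0 ≤ t ≤ T`
(the value `t = 0` only gives the zero function). -/
abbrev StepFn (T : ℝ) : Submodule ℝ (ℝ → ℝ) := Submodule.span ℝ (range (indFamily T))

theorem ind_mem_stepFn {T : ℝ} (t : Icc (0 : ℝ) T) : ind t ∈ StepFn T := by
  rcases t.2.1.eq_or_lt with h | h
  · rw [ind_of_eq_zero h.symm]
    exact zero_mem _
  · exact Submodule.subset_span ⟨⟨t, h, t.2.2⟩, rfl⟩

section Integrands

variable {Ω : Type*} [MeasurableSpace Ω] {P : Measure Ω} {T : ℝ} {X : Icc (0 : ℝ) T → Ω → ℝ}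

/-- The Wiener integral of step functions: the linear map `StepFn T → L²(P)` with
`1_{(0,t]} ↦ X_t`. -/
def stepIntegral (hX : IsCenteredGaussian X P) : StepFn T →ₗ[ℝ] Lp ℝ 2 P :=
  (Finsupp.linearCombination ℝ fun t : Ioc (0 : ℝ) T =>
      (hX.memLp (Set.inclusion Ioc_subset_Icc_self t)).toLp (X (Set.inclusion Ioc_subset_Icc_self t))) ∘ₗ
    (linearIndependent_indFamily T).repr

theorem stepIntegral_ind (hX : IsCenteredGaussian X P) (t : Icc (0 : ℝ) T) :
    stepIntegral hX ⟨ind t, ind_mem_stepFn t⟩ = (hX.memLp t).toLp (X t) := by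
  rcases t.2.1.eq_or_lt with h | h
  · have h0 : (⟨ind t, ind_mem_stepFn t⟩ : StepFn T) = 0 :=
      Subtype.ext (ind_of_eq_zero h.symm)
    rw [h0, map_zero, eq_comm, MemLp.toLp_eq_toLp_iff (hX.memLp t) MemLp.zero |>.2
      (hX.start t h.symm)]
    rfl
  · have hr := (linearIndependent_indFamily T).repr_eq_single ⟨t, h, t.2.2⟩
      ⟨ind t, ind_mem_stepFn t⟩ rfl
    rw [stepIntegral, LinearMap.comp_apply, hr, Finsupp.linearCombination_single, one_smul]

/-- Step functions, regarded as a semi-inner product space with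
`⟨1_{(0,t]}, 1_{(0,s]}⟩ = E[X_t X_s]`. -/
def PreIntegrands (_hX : IsCenteredGaussian X P) : Type := StepFn T

instance (hX : IsCenteredGaussian X P) : AddCommGroup (PreIntegrands hX) :=
  inferInstanceAs (AddCommGroup (StepFn T))

instance (hX : IsCenteredGaussian X P) : Module ℝ (PreIntegrands hX) :=
  inferInstanceAs (Module ℝ (StepFn T))

/-- `stepIntegral` as a map on `PreIntegrands`. -/
def preIntegral (hX : IsCenteredGaussian X P) : PreIntegrands hX →ₗ[ℝ] Lp ℝ 2 P :=
  stepIntegral hX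

instance (hX : IsCenteredGaussian X P) : SeminormedAddCommGroup (PreIntegrands hX) :=
  SeminormedAddCommGroup.induced _ _ (preIntegral hX)

instance (hX : IsCenteredGaussian X P) : InnerProductSpace ℝ (PreIntegrands hX) :=
  InnerProductSpace.induced (preIntegral hX)

/-- A step function as an element of `PreIntegrands`. -/
def PreIntegrands.of (hX : IsCenteredGaussian X P) : StepFn T →ₗ[ℝ] PreIntegrands hX :=
  LinearMap.id

/-- The space of deterministic integrands of `X`: the Hilbert space obtained as the closure of the
span of the functions `1_{(0,t]}`, `0 ≤ t ≤ T`, under the inner product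
`⟨1_{(0,t]}, 1_{(0,s]}⟩ = E[X_t X_s]`. -/
abbrev Integrands (hX : IsCenteredGaussian X P) : Type :=
  UniformSpace.Completion (PreIntegrands hX)

/-- A step function as a deterministic integrand. -/
def stepIntegrand (hX : IsCenteredGaussian X P) (f : StepFn T) : Integrands hX :=
  (PreIntegrands.of hX f : Integrands hX)

/-- The indicator `1_{(0,t]}` as a deterministic integrand. -/
def indIntegrand (hX : IsCenteredGaussian X P) (t : Icc (0 : ℝ) T) : Integrands hX :=
  stepIntegrand hX ⟨ind t, ind_mem_stepFn t⟩

theorem inner_indIntegrand (hX : IsCenteredGaussian X P) (t s : Icc (0 : ℝ) T) :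
    inner ℝ (indIntegrand hX t) (indIntegrand hX s) = ∫ ω, X t ω * X s ω ∂P := by
  rw [indIntegrand, indIntegrand, stepIntegrand, stepIntegrand,
    UniformSpace.Completion.inner_coe]
  change inner ℝ (stepIntegral hX ⟨ind t, ind_mem_stepFn t⟩)
    (stepIntegral hX ⟨ind s, ind_mem_stepFn s⟩) = _
  rw [stepIntegral_ind, stepIntegral_ind, L2.inner_def]
  apply integral_congr_ae
  filter_upwards [(hX.memLp t).coeFn_toLp, (hX.memLp s).coeFn_toLp] with ω h1 h2
  rw [h1, h2]
  simp [mul_comm]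

/-- The Wiener integral `I`: the linear isometry from the space of deterministic integrands to
`L²(P)` which extends `1_{(0,t]} ↦ X_t`. -/
def wienerIntegral (hX : IsCenteredGaussian X P) : Integrands hX →L[ℝ] Lp ℝ 2 P :=
  (⟨preIntegral hX, fun _ => rfl⟩ : PreIntegrands hX →ₗᵢ[ℝ] Lp ℝ 2 P).toContinuousLinearMap.extend
    UniformSpace.Completion.toComplL

theorem wienerIntegral_stepIntegrand (hX : IsCenteredGaussian X P) (f : StepFn T) :
    wienerIntegral hX (stepIntegrand hX f) = stepIntegral hX f :=
  ContinuousLinearMap.extend_eq _ UniformSpace.Completion.denseRange_coe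
    (UniformSpace.Completion.isUniformInducing_coe _) (PreIntegrands.of hX f)

theorem norm_stepIntegrand (hX : IsCenteredGaussian X P) (f : StepFn T) :
    ‖stepIntegrand hX f‖ = ‖stepIntegral hX f‖ :=
  UniformSpace.Completion.norm_coe (PreIntegrands.of hX f)

theorem wienerIntegral_indIntegrand (hX : IsCenteredGaussian X P) (t : Icc (0 : ℝ) T) :
    wienerIntegral hX (indIntegrand hX t) = (hX.memLp t).toLp (X t) := by
  rw [indIntegrand, wienerIntegral_stepIntegrand, stepIntegral_ind]

theorem norm_wienerIntegral (hX : IsCenteredGaussian X P) (h : Integrands hX) :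
    ‖wienerIntegral hX h‖ = ‖h‖ := by
  induction h using UniformSpace.Completion.induction_on with
  | hp => exact isClosed_eq (by fun_prop) (by fun_prop)
  | ih a =>
    rw [UniformSpace.Completion.norm_coe]
    exact congrArg norm (wienerIntegral_stepIntegrand hX a)

end Integrands

/-- `X` has an indefinite Wiener integral: `X` is a centered Gaussian process starting at `0` and,
for every `r ∈ [0, T]`, there is a continuous linear operator on the space of deterministic
integrands which maps `1_{(0,t]}` to `1_{(0, t ∧ r]}` for all `t ∈ [0, T]`. -/
def HasIndefiniteWienerIntegral {Ω : Type*} [MeasurableSpace Ω] {T : ℝ}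
    (X : Icc (0 : ℝ) T → Ω → ℝ) (P : Measure Ω) : Prop :=
  ∃ hX : IsCenteredGaussian X P, ∀ r : Icc (0 : ℝ) T,
    ∃ A : Integrands hX →L[ℝ] Integrands hX,
      ∀ t : Icc (0 : ℝ) T, A (indIntegrand hX t) = indIntegrand hX (min t r)

/-- The squared norm
`∫_0^T ∫_0^T |f(s)| |f(u)| |s - u|^{2H-2} du ds` (up to the factor `H (2H - 1)`) of the usual space
of functions that are integrable with respect to a fractional Brownian motion with `H > 1/2`. -/
def fracNormSq (H T : ℝ) (f : ℝ → ℝ) : ℝ≥0∞ :=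
  ∫⁻ s in Icc 0 T, ∫⁻ u in Icc 0 T,
    ‖f s‖ₑ * ‖f u‖ₑ * ENNReal.ofReal (|s - u| ^ (2 * H - 2))

/-- `Y` is (a version of) the fractional Wiener integral `∫_0^T f dB`, where `B` is a fractional
Brownian motion with `H > 1/2`: it is the Wiener integral of the deterministic integrand `h` which
the function `f` represents, that is, of the limit `h` of step functions that approximate `f` in
the norm above. -/
def IsFractionalWienerIntegral {Ω : Type*} [MeasurableSpace Ω] {P : Measure Ω} {T : ℝ} {H : ℝ}
    {B : Icc (0 : ℝ) T → Ω → ℝ} (hB : IsFractionalBrownianMotion H B P)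
    (f : ℝ → ℝ) (Y : Ω → ℝ) : Prop :=
  ∃ h : Integrands hB.toIsCenteredGaussian,
    (∃ φ : ℕ → StepFn T,
      Tendsto (fun n => fracNormSq H T ((φ n : ℝ → ℝ) - f)) atTop (𝓝 0) ∧
      Tendsto (fun n => stepIntegrand hB.toIsCenteredGaussian (φ n)) atTop (𝓝 h)) ∧
    Y =ᵐ[P] wienerIntegral hB.toIsCenteredGaussian h

end WienerInt

end

/-! Everything reduces to step functions: if `‖I(1_{(0,r]} f)‖ ≤ C ‖I(f)‖` with `C` independent of
the step function `f`, then truncation extends continuously to the space of integrands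
(`exists_indefinite_operator`).

(i) Put `α = 2H` and write `I(f) = x + y`, with `y` in the span of the increments `B_t - B_r`, `t ≤
r`, and `x` in the span of those with `t ≥ r`. The bound `‖y‖ ≤ K ‖x + y‖` says that past and future
form a positive angle (`fracCrossCov_le`, `norm_le_norm_add_of_fracCov`). For `α ≠ 1` the covariance
of past and future is `1/(2C)` times the inner product of two sums `Σ c_i (1 - exp(-u_i x))` in
`L²(x^(-1-α) dx)`. Hence it suffices that the energy `E` of one such sum satisfies `E/(2|C|) ≤ ρ Q`
with `ρ < 1`, where `Q` is the variance of the same combination of increments. The difference `Q -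
E/(2|C|)` is, up to a positive constant, the energy of `Σ c_i sin(u_i x)` if `α < 1` and of `Σ c_i
(1 - cos(u_i x))` if `α > 1`. Since `1 - exp(-t l)` is the integral of `sin(t x)`, or of `1 - cos(t
x)`, against a positive kernel homogeneous of degree `-1`, a Schur test bounds `E` by a multiple of
that energy. For `α = 1` past and future are orthogonal.

(ii) For `H > 1/2` the norm of a step function is a double integral against `|s - u|^(2H-2)`,
dominated by `fracNormSq`. Writing this kernel as a convolution square shows that `fracNormSq` is
subadditive up to the factor 2, so `1_{(0,t]} σ` represents a unique integrand `h_t`; it exists by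
approximation in `L²`. The operator `A` of `B` sends `h_t` to `h_{t ∧ r}`, and `1_{(0,t]} ↦ h_t`
preserves norms from the integrands of `X` to those of `B`, so `C = ‖A‖` works for `X`. Gaussianity
survives `L²` limits by characteristic functions.

(iii) Independence makes the two Wiener integrals orthogonal, so squared norms add and the two
truncation bounds combine. -/

noncomputable section

namespace WienerInt

/-! ### The Fourier transform of the Laplace density -/

section Fourier
open FourierTransform Real

theorem integrable_exp_neg_abs : Integrable (fun v : ℝ => Real.exp (-|v|)) := by
  rw [← integrableOn_univ, ← Iic_union_Ioi (a := (0 : ℝ))]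
  refine IntegrableOn.union ?_ ?_
  · refine (integrableOn_exp_Iic 0).congr_fun (fun v hv => ?_) measurableSet_Iic
    simp only [abs_of_nonpos (mem_Iic.1 hv), neg_neg]
  · refine (integrableOn_exp_neg_Ioi 0).congr_fun (fun v hv => ?_) measurableSet_Ioi
    simp only [abs_of_pos (mem_Ioi.1 hv)]

theorem fourier_exp_neg_abs (w : ℝ) :
    𝓕 (fun v : ℝ => (Real.exp (-|v|) : ℂ)) w = ((2 / (1 + (2 * π * w) ^ 2) : ℝ) : ℂ) := by
  rw [Real.fourier_real_eq_integral_exp_smul]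
  have hint : Integrable (fun v : ℝ =>
      Complex.exp (↑(-2 * π * v * w) * Complex.I) • (Real.exp (-|v|) : ℂ)) := by
    refine (integrable_exp_neg_abs.ofReal (𝕜 := ℂ)).bdd_mul (c := 1) (by fun_prop) ?_
    exact Eventually.of_forall fun v => (Complex.norm_exp_ofReal_mul_I _).le
  rw [← intervalIntegral.integral_Iic_add_Ioi (b := 0) hint.integrableOn hint.integrableOn]
  have h1 : ∫ v in Iic (0 : ℝ), Complex.exp (↑(-2 * π * v * w) * Complex.I) •
      (Real.exp (-|v|) : ℂ) = ∫ v in Iic (0 : ℝ), Complex.exp ((1 - 2 * π * w * Complex.I) * v) := by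
    refine setIntegral_congr_fun measurableSet_Iic fun v hv => ?_
    simp only [abs_of_nonpos (mem_Iic.1 hv), smul_eq_mul, Complex.ofReal_exp, ← Complex.exp_add]
    congr 1; push_cast; ring
  have h2 : ∫ v in Ioi (0 : ℝ), Complex.exp (↑(-2 * π * v * w) * Complex.I) •
      (Real.exp (-|v|) : ℂ) = ∫ v in Ioi (0 : ℝ), Complex.exp ((-1 - 2 * π * w * Complex.I) * v) := by
    refine setIntegral_congr_fun measurableSet_Ioi fun v hv => ?_
    simp only [abs_of_pos (mem_Ioi.1 hv), smul_eq_mul, Complex.ofReal_exp, ← Complex.exp_add]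
    congr 1; push_cast; ring
  rw [h1, h2, integral_exp_mul_complex_Iic (by simp), integral_exp_mul_complex_Ioi (by simp)]
  have e1 : (1 - 2 * π * w * Complex.I : ℂ) ≠ 0 := fun h => by simpa using congrArg Complex.re h
  have e2 : (-1 - 2 * π * w * Complex.I : ℂ) ≠ 0 := fun h => by simpa using congrArg Complex.re h
  have e3 : ((1 : ℂ) + (2 * π * w) ^ 2) ≠ 0 := by
    have : (1 + (2 * π * w) ^ 2 : ℝ) ≠ 0 := by positivity
    exact_mod_cast this
  push_cast
  simp only [mul_zero, Complex.exp_zero]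
  have e4 : (1 - 2 * π * w * Complex.I : ℂ) * (-1 - 2 * π * w * Complex.I) =
      -(1 + (2 * π * w) ^ 2) := by linear_combination (2 * π * w : ℂ) ^ 2 * Complex.I_sq
  rw [eq_div_iff e3, ← neg_inj, ← mul_neg, ← e4]
  field_simp
  ring

/-- This is Fourier inversion for `exp(-|v|)`: take real parts, substitute `x = 2πw`, and fold the
even integrand onto the half-line. -/
theorem integral_cos_div_one_add_sq (v : ℝ) :
    ∫ x in Ioi (0 : ℝ), Real.cos (x * v) * (1 + x ^ 2)⁻¹ = π / 2 * Real.exp (-|v|) := by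
  have hg : Integrable (fun w : ℝ => ((2 / (1 + (2 * π * w) ^ 2) : ℝ) : ℂ)) := by
    have := (integrable_inv_one_add_sq.comp_mul_left' (g := fun x : ℝ => (1 + x ^ 2)⁻¹)
      (R := 2 * π) (by positivity)).const_mul 2
    simp only [← div_eq_mul_inv] at this
    exact this.ofReal (𝕜 := ℂ)
  have hF : 𝓕 (fun v : ℝ => (Real.exp (-|v|) : ℂ)) =
      fun w : ℝ => ((2 / (1 + (2 * π * w) ^ 2) : ℝ) : ℂ) := funext fourier_exp_neg_abs
  have hinv := congrFun (Continuous.fourierInv_fourier_eq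
    (f := fun v : ℝ => (Real.exp (-|v|) : ℂ)) (by fun_prop)
    (integrable_exp_neg_abs.ofReal (𝕜 := ℂ)) (by rw [hF]; exact hg)) v
  rw [hF, Real.fourierInv_eq'] at hinv
  have hre := congrArg Complex.re hinv
  have hint : Integrable (fun w : ℝ => Complex.exp (↑(2 * π * inner ℝ w v) * Complex.I) •
      ((2 / (1 + (2 * π * w) ^ 2) : ℝ) : ℂ)) := by
    refine hg.bdd_mul (c := 1) (Continuous.aestronglyMeasurable (by fun_prop)) ?_
    exact Eventually.of_forall fun v => (Complex.norm_exp_ofReal_mul_I _).le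
  have hre' := integral_re hint
  simp only [RCLike.re_to_complex] at hre'
  rw [← hre', Complex.ofReal_re] at hre
  have hcong : (fun w : ℝ => (Complex.exp (↑(2 * π * inner ℝ w v) * Complex.I) •
      ((2 / (1 + (2 * π * w) ^ 2) : ℝ) : ℂ)).re) =
      fun w : ℝ => (fun x => 2 * (Real.cos (|x| * v) * (1 + |x| ^ 2)⁻¹)) (2 * π * w) := by
    funext w
    rw [smul_eq_mul, Complex.re_mul_ofReal, Complex.exp_ofReal_mul_I_re]
    have : Real.cos (|2 * π * w| * v) = Real.cos (2 * π * inner ℝ w v) := by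
      rw [← Real.cos_abs, abs_mul, abs_abs, ← abs_mul, Real.cos_abs]
      simp only [inner]
      congr 1; simp; ring
    simp only [this, sq_abs]
    ring
  rw [hcong, Measure.integral_comp_mul_left (fun x => 2 * (Real.cos (|x| * v) * (1 + |x| ^ 2)⁻¹)),
    integral_comp_abs
    (f := fun x : ℝ => 2 * (Real.cos (x * v) * (1 + x ^ 2)⁻¹)), integral_const_mul, smul_eq_mul,
    abs_of_pos (by positivity)] at hre
  rw [← hre, ← mul_assoc 2 2, ← mul_assoc, ← mul_assoc]
  rw [show π / 2 * (2 * π)⁻¹ * (2 * 2) = 1 by field_simp, one_mul]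

theorem integrableOn_div_sq_add_sq {l : ℝ} (hl : 0 < l) :
    IntegrableOn (fun x : ℝ => l / (x ^ 2 + l ^ 2)) (Ioi 0) := by
  have := (integrable_inv_one_add_sq.comp_mul_left' (g := fun x : ℝ => (1 + x ^ 2)⁻¹)
      (R := l⁻¹) (by positivity)).const_mul l⁻¹
  refine this.integrableOn.congr_fun (fun x _ => ?_) measurableSet_Ioi
  field_simp
  ring

theorem integral_cos_mul_div {t l : ℝ} (ht : 0 ≤ t) (hl : 0 < l) :
    ∫ x in Ioi (0 : ℝ), Real.cos (t * x) * (l / (x ^ 2 + l ^ 2)) = π / 2 * Real.exp (-(t * l)) := by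
  have h := integral_comp_mul_left_Ioi (fun x => Real.cos (t * x) * (l / (x ^ 2 + l ^ 2))) 0 hl
  rw [mul_zero, smul_eq_mul, eq_inv_mul_iff_mul_eq₀ hl.ne'] at h
  rw [← h, ← integral_const_mul, ← abs_of_nonneg (mul_nonneg ht hl.le),
    ← integral_cos_div_one_add_sq]
  refine setIntegral_congr_fun measurableSet_Ioi fun x _ => ?_
  rw [show t * (l * x) = x * (t * l) by ring]
  field_simp
  ring

/-- The kernel `l / (x² + l²)` turns cosine sums into Laplace sums; this is what `laplace_le_cos`
feeds to the Schur test. -/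
theorem integral_one_sub_cos_mul_div {t l : ℝ} (ht : 0 ≤ t) (hl : 0 < l) :
    ∫ x in Ioi (0 : ℝ), (1 - Real.cos (t * x)) * (l / (x ^ 2 + l ^ 2)) =
      π / 2 * (1 - Real.exp (-(t * l))) := by
  have h0 := integral_cos_mul_div le_rfl hl
  simp only [zero_mul, Real.cos_zero, one_mul, neg_zero, Real.exp_zero] at h0
  have hi := integrableOn_div_sq_add_sq hl
  have hc : IntegrableOn (fun x : ℝ => Real.cos (t * x) * (l / (x ^ 2 + l ^ 2))) (Ioi 0) :=
    hi.bdd_mul (c := 1) (by fun_prop) (Eventually.of_forall fun x => Real.abs_cos_le_one _)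
  simp only [sub_mul, one_mul]
  rw [integral_sub hi hc, h0, integral_cos_mul_div ht hl]
  ring

/-- Obtained by multiplying `integral_cos_mul_div` by `l`, integrating over the time variable in
`(0, t]` and exchanging integrals. It supplies the kernel of `laplace_le_sin`. -/
theorem integral_sin_mul_div {t l : ℝ} (ht : 0 ≤ t) (hl : 0 < l) :
    ∫ x in Ioi (0 : ℝ), Real.sin (t * x) * (l ^ 2 / (x * (x ^ 2 + l ^ 2))) =
      π / 2 * (1 - Real.exp (-(t * l))) := by
  have hi := integrableOn_div_sq_add_sq hl
  have hprod : Integrable (Function.uncurry fun (x v : ℝ) =>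
      Real.cos (v * x) * (l * (l / (x ^ 2 + l ^ 2))))
      ((volume.restrict (Ioi 0)).prod (volume.restrict (Ioc 0 t))) := by
    have h1 : Integrable (fun _ : ℝ => (1 : ℝ)) (volume.restrict (Ioc 0 t)) := by simp
    have h2 := (hi.const_mul l).mul_prod h1
    refine (h2.bdd_mul (c := 1) (f := fun z : ℝ × ℝ => Real.cos (z.2 * z.1))
      (by fun_prop) (Eventually.of_forall fun x => Real.abs_cos_le_one _)).congr ?_
    exact Eventually.of_forall fun z => by simp [Function.uncurry]
  have hs := integral_integral_swap hprod
  have hl1 : ∀ x ∈ Ioi (0 : ℝ), ∫ v in Ioc 0 t, Real.cos (v * x) * (l * (l / (x ^ 2 + l ^ 2))) =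
      Real.sin (t * x) * (l ^ 2 / (x * (x ^ 2 + l ^ 2))) := fun x hx => by
    have hx0 : x ≠ 0 := (mem_Ioi.1 hx).ne'
    rw [integral_mul_const, ← intervalIntegral.integral_of_le ht,
      intervalIntegral.integral_comp_mul_right (fun y => Real.cos y) hx0, integral_cos]
    simp
    field_simp
  rw [setIntegral_congr_fun measurableSet_Ioi hl1] at hs
  rw [hs]
  have hl2 : ∀ v ∈ Ioc 0 t, ∫ x in Ioi (0 : ℝ), Real.cos (v * x) * (l * (l / (x ^ 2 + l ^ 2))) =
      π / 2 * (l * Real.exp (v * (-l))) := fun v hv => by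
    have := integral_cos_mul_div hv.1.le hl
    simp only [mul_left_comm _ l, integral_const_mul, this]
    ring_nf
  rw [setIntegral_congr_fun measurableSet_Ioc hl2, integral_const_mul, integral_const_mul,
    ← intervalIntegral.integral_of_le ht,
    intervalIntegral.integral_comp_mul_right (fun y => Real.exp y) (neg_ne_zero.2 hl.ne'),
    integral_exp]
  simp
  field_simp
  ring

end Fourier

/-! ### Homogeneous kernels on the half-line -/

theorem integrableOn_Ioi_of_rpow_bounds {f : ℝ → ℝ} (hf : Measurable f) {A B p q : ℝ}
    (hp : -1 < p) (hq : q < -1) (h0 : ∀ x ∈ Ioc (0 : ℝ) 1, |f x| ≤ A * x ^ p)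
    (h1 : ∀ x ∈ Ioi (1 : ℝ), |f x| ≤ B * x ^ q) : IntegrableOn f (Ioi 0) := by
  rw [← Ioc_union_Ioi_eq_Ioi (zero_le_one' ℝ)]
  refine IntegrableOn.union ?_ ?_
  · have hi : IntegrableOn (fun x : ℝ => x ^ p) (Ioc 0 1) :=
      (intervalIntegrable_iff_integrableOn_Ioc_of_le zero_le_one).1
        (intervalIntegral.intervalIntegrable_rpow' hp)
    exact (hi.const_mul A).mono' hf.aestronglyMeasurable
      (ae_restrict_of_forall_mem measurableSet_Ioc h0)
  · exact ((integrableOn_Ioi_rpow_of_lt hq one_pos).const_mul B).mono' hf.aestronglyMeasurable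
      (ae_restrict_of_forall_mem measurableSet_Ioi h1)

theorem integrableOn_rpow_div_one_add_sq {s : ℝ} (h0 : -1 < s) (h1 : s < 1) :
    IntegrableOn (fun x : ℝ => x ^ s / (x ^ 2 + 1)) (Ioi 0) := by
  refine integrableOn_Ioi_of_rpow_bounds (A := 1) (B := 1) (p := s) (q := s - 2)
    (by fun_prop) h0 (by linarith) (fun x hx => ?_) (fun x hx => ?_)
  · have hs := Real.rpow_nonneg hx.1.le s
    rw [abs_of_nonneg (by positivity), one_mul]
    exact div_le_self hs (by nlinarith)
  · have hx0 : 0 < x := one_pos.trans hx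
    have hs := Real.rpow_nonneg hx0.le s
    rw [abs_of_nonneg (by positivity), one_mul, Real.rpow_sub hx0, Real.rpow_two]
    exact div_le_div_of_nonneg_left hs (by positivity) (by linarith)

/-- Scaling `x ↦ l x` reduces to `l = 1`. All four Schur conditions below take this form. -/
theorem lintegral_rpow_div_sq_add_sq {s : ℝ} (h0 : -1 < s) (h1 : s < 1) {l : ℝ} (hl : 0 < l) :
    ∫⁻ x in Ioi (0 : ℝ), ENNReal.ofReal (x ^ s / (x ^ 2 + l ^ 2)) =
      ENNReal.ofReal ((∫ x in Ioi (0 : ℝ), x ^ s / (x ^ 2 + 1)) * l ^ (s - 1)) := by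
  have hcomp : ∀ x ∈ Ioi (0 : ℝ), (l * x) ^ s / ((l * x) ^ 2 + l ^ 2) =
      l ^ (s - 2) * (x ^ s / (x ^ 2 + 1)) := fun x hx => by
    rw [Real.mul_rpow hl.le (mem_Ioi.1 hx).le, Real.rpow_sub hl, Real.rpow_two]
    field_simp
  have hi : IntegrableOn (fun x : ℝ => x ^ s / (x ^ 2 + l ^ 2)) (Ioi 0) := by
    have h := integrableOn_Ioi_comp_mul_left_iff (fun x : ℝ => x ^ s / (x ^ 2 + l ^ 2)) 0 hl
    rw [mul_zero] at h
    refine h.1 (IntegrableOn.congr_fun ?_ (fun x hx => (hcomp x hx).symm) measurableSet_Ioi)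
    exact (integrableOn_rpow_div_one_add_sq h0 h1).const_mul _
  rw [← ofReal_integral_eq_lintegral_ofReal hi
    (ae_restrict_of_forall_mem measurableSet_Ioi fun x hx =>
      div_nonneg (Real.rpow_nonneg (mem_Ioi.1 hx).le s) (by positivity))]
  congr 1
  have h := integral_comp_mul_left_Ioi (fun x : ℝ => x ^ s / (x ^ 2 + l ^ 2)) 0 hl
  rw [mul_zero, smul_eq_mul, eq_inv_mul_iff_mul_eq₀ hl.ne',
    setIntegral_congr_fun measurableSet_Ioi hcomp, integral_const_mul] at h
  rw [← h, show s - 1 = 1 + (s - 2) by ring, Real.rpow_add hl, Real.rpow_one]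
  ring

theorem sq_lintegral_mul_le {α : Type*} [MeasurableSpace α] (μ : Measure α) {f g : α → ℝ≥0∞}
    (hf : AEMeasurable f μ) (hg : AEMeasurable g μ) :
    (∫⁻ a, f a * g a ∂μ) ^ 2 ≤ (∫⁻ a, f a ^ 2 ∂μ) * ∫⁻ a, g a ^ 2 ∂μ := by
  have h := ENNReal.lintegral_mul_le_Lp_mul_Lq μ Real.HolderConjugate.two_two hf hg
  simp only [Pi.mul_apply, ENNReal.rpow_two] at h
  refine (pow_le_pow_left' h 2).trans_eq ?_
  rw [mul_pow, ← ENNReal.rpow_two, ← ENNReal.rpow_two, ← ENNReal.rpow_mul, ← ENNReal.rpow_mul]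
  norm_num

/-- The Schur test with power weights. -/
theorem lintegral_sq_kernel_le {k : ℝ → ℝ → ℝ≥0∞} (hk : Measurable (Function.uncurry k))
    {f : ℝ → ℝ≥0∞} (hf : Measurable f) (β γ : ℝ) {C₁ C₂ : ℝ≥0∞}
    (h₁ : ∀ l ∈ Ioi (0 : ℝ), ∫⁻ x in Ioi 0, k l x * ENNReal.ofReal (x ^ β) ≤
      C₁ * ENNReal.ofReal (l ^ β))
    (h₂ : ∀ x ∈ Ioi (0 : ℝ), ∫⁻ l in Ioi 0, k l x * ENNReal.ofReal (l ^ (γ + β)) ≤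
      C₂ * ENNReal.ofReal (x ^ (γ + β))) :
    ∫⁻ l in Ioi (0 : ℝ), (∫⁻ x in Ioi 0, k l x * f x) ^ 2 * ENNReal.ofReal (l ^ γ) ≤
      C₁ * C₂ * ∫⁻ x in Ioi (0 : ℝ), f x ^ 2 * ENNReal.ofReal (x ^ γ) := by
  have hk1 : ∀ l, Measurable (k l) := fun l => hk.of_uncurry_left
  have hk2 : ∀ x, Measurable (fun l => k l x) := fun x => hk.of_uncurry_right
  have hpow : ∀ b : ℝ, Measurable (fun x : ℝ => ENNReal.ofReal (x ^ b)) := fun b => by fun_prop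
  have hCS : ∀ l ∈ Ioi (0 : ℝ), (∫⁻ x in Ioi 0, k l x * f x) ^ 2 * ENNReal.ofReal (l ^ γ) ≤
      C₁ * ∫⁻ x in Ioi 0, k l x * ENNReal.ofReal (l ^ (γ + β)) *
        (ENNReal.ofReal (x ^ (-β)) * f x ^ 2) := by
    intro l hl
    -- Split `k f = (k x^β)^(1/2) (k x^(-β) f²)^(1/2)`, so that after Cauchy–Schwarz the first
    -- factor is controlled by `h₁`.
    have e : ∫⁻ x in Ioi 0, k l x * f x = ∫⁻ x in Ioi 0,
        ((k l x * ENNReal.ofReal (x ^ β)) ^ (1 / 2 : ℝ)) *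
        ((k l x * (ENNReal.ofReal (x ^ (-β)) * f x ^ 2)) ^ (1 / 2 : ℝ)) := by
      refine setLIntegral_congr_fun measurableSet_Ioi fun x hx => ?_
      have hx0 : (0 : ℝ) < x := hx
      rw [← ENNReal.mul_rpow_of_nonneg _ _ (by norm_num : (0 : ℝ) ≤ 1 / 2)]
      have : k l x * ENNReal.ofReal (x ^ β) * (k l x * (ENNReal.ofReal (x ^ (-β)) * f x ^ 2)) =
          (k l x * f x) ^ 2 * (ENNReal.ofReal (x ^ β) * ENNReal.ofReal (x ^ (-β))) := by ring
      rw [this, ← ENNReal.ofReal_mul (Real.rpow_nonneg hx0.le _), ← Real.rpow_add hx0]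
      simp only [add_neg_cancel, Real.rpow_zero, ENNReal.ofReal_one, mul_one]
      rw [← ENNReal.rpow_two, ← ENNReal.rpow_mul]
      norm_num
    rw [e]
    have hsq : ∀ z : ℝ≥0∞, (z ^ (1 / 2 : ℝ)) ^ 2 = z := fun z => by
      rw [← ENNReal.rpow_two, ← ENNReal.rpow_mul]; norm_num
    have hCS := sq_lintegral_mul_le (volume.restrict (Ioi (0 : ℝ)))
      (f := fun x => (k l x * ENNReal.ofReal (x ^ β)) ^ (1 / 2 : ℝ))
      (g := fun x => (k l x * (ENNReal.ofReal (x ^ (-β)) * f x ^ 2)) ^ (1 / 2 : ℝ))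
      (by fun_prop) (by fun_prop)
    simp only [hsq] at hCS
    calc _ ≤ (C₁ * ENNReal.ofReal (l ^ β)) * (∫⁻ x in Ioi 0,
            k l x * (ENNReal.ofReal (x ^ (-β)) * f x ^ 2)) * ENNReal.ofReal (l ^ γ) := by
          gcongr
          exact hCS.trans (by gcongr; exact h₁ l hl)
      _ = C₁ * (ENNReal.ofReal (l ^ (γ + β)) * (∫⁻ x in Ioi 0,
            k l x * (ENNReal.ofReal (x ^ (-β)) * f x ^ 2))) := by
          rw [Real.rpow_add hl, ENNReal.ofReal_mul (Real.rpow_nonneg (mem_Ioi.1 hl).le _)]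
          ring
      _ = _ := by
          rw [← lintegral_const_mul _ (by fun_prop)]
          congr 2 with x
          ring
  -- Tonelli puts the `l`-integral inside, where `h₂` applies; the powers `x^(γ+β)` and `x^(-β)`
  -- then recombine to `x^γ`.
  calc _ ≤ ∫⁻ l in Ioi (0 : ℝ), C₁ * ∫⁻ x in Ioi 0, k l x * ENNReal.ofReal (l ^ (γ + β)) *
        (ENNReal.ofReal (x ^ (-β)) * f x ^ 2) := setLIntegral_mono' measurableSet_Ioi hCS
    _ = C₁ * ∫⁻ x in Ioi (0 : ℝ), ∫⁻ l in Ioi 0, k l x * ENNReal.ofReal (l ^ (γ + β)) *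
        (ENNReal.ofReal (x ^ (-β)) * f x ^ 2) := by
      have hm : Measurable (Function.uncurry fun (l x : ℝ) =>
          k l x * ENNReal.ofReal (l ^ (γ + β)) * (ENNReal.ofReal (x ^ (-β)) * f x ^ 2)) :=
        (hk.mul ((hpow _).comp measurable_fst)).mul
          (((hpow _).comp measurable_snd).mul ((hf.pow_const 2).comp measurable_snd))
      rw [lintegral_const_mul _ hm.lintegral_prod_right, lintegral_lintegral_swap hm.aemeasurable]
    _ ≤ C₁ * ∫⁻ x in Ioi (0 : ℝ), C₂ * (f x ^ 2 * ENNReal.ofReal (x ^ γ)) := by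
      gcongr C₁ * ?_
      refine setLIntegral_mono' measurableSet_Ioi fun x hx => ?_
      rw [lintegral_mul_const _ (by fun_prop)]
      refine (mul_le_mul_left (h₂ x hx) _).trans_eq ?_
      rw [show C₂ * ENNReal.ofReal (x ^ (γ + β)) * (ENNReal.ofReal (x ^ (-β)) * f x ^ 2) =
        C₂ * (f x ^ 2 * (ENNReal.ofReal (x ^ (γ + β)) * ENNReal.ofReal (x ^ (-β)))) by ring,
        ← ENNReal.ofReal_mul (Real.rpow_nonneg (mem_Ioi.1 hx).le _), ← Real.rpow_add hx,
        add_neg_cancel_right]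
    _ = _ := by
      rw [lintegral_const_mul _ (by fun_prop), mul_assoc]

/-- The Schur test with power weights for real integrals. -/
theorem integral_sq_kernel_le {k : ℝ → ℝ → ℝ} (hk : Measurable (Function.uncurry k))
    (hk0 : ∀ l ∈ Ioi (0 : ℝ), ∀ x ∈ Ioi (0 : ℝ), 0 ≤ k l x) (β γ : ℝ) {C₁ C₂ : ℝ}
    (h₁ : ∀ l ∈ Ioi (0 : ℝ), ∫⁻ x in Ioi 0, ENNReal.ofReal (k l x * x ^ β) ≤
      ENNReal.ofReal (C₁ * l ^ β))
    (h₂ : ∀ x ∈ Ioi (0 : ℝ), ∫⁻ l in Ioi 0, ENNReal.ofReal (k l x * l ^ (γ + β)) ≤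
      ENNReal.ofReal (C₂ * x ^ (γ + β))) (hC₁ : 0 ≤ C₁) (hC₂ : 0 ≤ C₂)
    {F G : ℝ → ℝ} (hF : Measurable F)
    (hFi : IntegrableOn (fun x => F x ^ 2 * x ^ γ) (Ioi 0))
    (hGi : IntegrableOn (fun x => G x ^ 2 * x ^ γ) (Ioi 0))
    (hFG : ∀ l ∈ Ioi (0 : ℝ), G l = ∫ x in Ioi 0, F x * k l x) :
    ∫ l in Ioi (0 : ℝ), G l ^ 2 * l ^ γ ≤ C₁ * C₂ * ∫ x in Ioi (0 : ℝ), F x ^ 2 * x ^ γ := by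
  have hpos : ∀ (F : ℝ → ℝ), 0 ≤ᵐ[volume.restrict (Ioi (0 : ℝ))] fun x => F x ^ 2 * x ^ γ :=
    fun F => ae_restrict_of_forall_mem measurableSet_Ioi fun x hx =>
      mul_nonneg (sq_nonneg _) (Real.rpow_nonneg (mem_Ioi.1 hx).le _)
  have hS := lintegral_sq_kernel_le (k := fun l x => ENNReal.ofReal (k l x)) (by fun_prop)
    (f := fun x => ‖F x‖ₑ) hF.enorm β γ (C₁ := ENNReal.ofReal C₁) (C₂ := ENNReal.ofReal C₂)
    (fun l hl => by
      rw [← ENNReal.ofReal_mul hC₁]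
      refine le_trans (le_of_eq ?_) (h₁ l hl)
      exact setLIntegral_congr_fun measurableSet_Ioi fun x hx =>
        (ENNReal.ofReal_mul (hk0 l hl x hx)).symm)
    (fun x hx => by
      rw [← ENNReal.ofReal_mul hC₂]
      refine le_trans (le_of_eq ?_) (h₂ x hx)
      exact setLIntegral_congr_fun measurableSet_Ioi fun l hl =>
        (ENNReal.ofReal_mul (hk0 l hl x hx)).symm)
  have hsq : ∀ F : ℝ → ℝ, ∀ x ∈ Ioi (0 : ℝ),
      ENNReal.ofReal (F x ^ 2 * x ^ γ) = ‖F x‖ₑ ^ 2 * ENNReal.ofReal (x ^ γ) := fun F x _ => by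
    rw [ENNReal.ofReal_mul (sq_nonneg _), ← sq_abs, ENNReal.ofReal_pow (abs_nonneg _),
      Real.enorm_eq_ofReal_abs]
  rw [← ENNReal.ofReal_le_ofReal_iff (mul_nonneg (mul_nonneg hC₁ hC₂)
      (integral_nonneg_of_ae (hpos F))), ENNReal.ofReal_mul (mul_nonneg hC₁ hC₂),
    ENNReal.ofReal_mul hC₁, ofReal_integral_eq_lintegral_ofReal hGi (hpos G),
    ofReal_integral_eq_lintegral_ofReal hFi (hpos F),
    setLIntegral_congr_fun measurableSet_Ioi (hsq F),
    setLIntegral_congr_fun measurableSet_Ioi (hsq G)]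
  refine le_trans (setLIntegral_mono' measurableSet_Ioi fun l hl => ?_) hS
  gcongr
  rw [hFG l hl]
  refine (enorm_integral_le_lintegral_enorm _).trans (le_of_eq ?_)
  refine setLIntegral_congr_fun measurableSet_Ioi fun x hx => ?_
  simp only [enorm_mul]
  rw [mul_comm, Real.enorm_of_nonneg (hk0 l hl x hx)]

/-! ### Spectral representations of fractional covariances -/

theorem integrableOn_comp_mul_rpow {g : ℝ → ℝ} {α : ℝ} (g0 : g 0 = 0)
    (hg : IntegrableOn (fun x => g x * x ^ (-1 - α)) (Ioi 0)) {u : ℝ} (hu : 0 ≤ u) :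
    IntegrableOn (fun x => g (u * x) * x ^ (-1 - α)) (Ioi 0) := by
  rcases hu.eq_or_lt with rfl | hu
  · simp [g0]
  have h := integrableOn_Ioi_comp_mul_left_iff (fun x => g x * x ^ (-1 - α)) 0 hu
  rw [mul_zero] at h
  refine IntegrableOn.congr_fun ((h.2 hg).const_mul (u ^ (1 + α))) (fun x hx => ?_)
    measurableSet_Ioi
  rw [Real.mul_rpow hu.le (mem_Ioi.1 hx).le, show -1 - α = -(1 + α) by ring,
    Real.rpow_neg hu.le]
  have := (Real.rpow_pos_of_pos hu (1 + α)).ne'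
  field_simp

theorem integral_comp_mul_rpow {g : ℝ → ℝ} {α : ℝ} (hα : α ≠ 0) (g0 : g 0 = 0) {u : ℝ}
    (hu : 0 ≤ u) : ∫ x in Ioi (0 : ℝ), g (u * x) * x ^ (-1 - α) =
      u ^ α * ∫ x in Ioi (0 : ℝ), g x * x ^ (-1 - α) := by
  rcases hu.eq_or_lt with rfl | hu
  · simp [g0, Real.zero_rpow hα]
  have h := integral_comp_mul_left_Ioi (fun x => g x * x ^ (-1 - α)) 0 hu
  rw [mul_zero, smul_eq_mul, eq_inv_mul_iff_mul_eq₀ hu.ne'] at h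
  rw [← h, ← integral_const_mul, ← integral_const_mul]
  refine setIntegral_congr_fun measurableSet_Ioi fun x hx => ?_
  rw [Real.mul_rpow hu.le (mem_Ioi.1 hx).le, show -1 - α = -(1 + α) by ring,
    Real.rpow_neg hu.le, Real.rpow_add hu, Real.rpow_one]
  have := (Real.rpow_pos_of_pos hu α).ne'
  field_simp

theorem setIntegral_Ioi_pos {f : ℝ → ℝ} (hf : IntegrableOn f (Ioi 0))
    (h0 : ∀ x ∈ Ioi (0 : ℝ), 0 ≤ f x) (h1 : ∀ x ∈ Ioo (0 : ℝ) 1, 0 < f x) :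
    0 < ∫ x in Ioi (0 : ℝ), f x := by
  rw [setIntegral_pos_iff_support_of_nonneg_ae
    (ae_restrict_of_forall_mem measurableSet_Ioi h0) hf]
  refine lt_of_lt_of_le ?_ (measure_mono (s := Ioo 0 1) fun x hx => ⟨(h1 x hx).ne', hx.1⟩)
  simp

/-- The product `(1 - e^(-x))(1 - e^(-y))` equals `g x + g y - g (x + y)` for `g x = 1 - e^(-x)`,
and also after subtracting the linear term `x` from `g`. The first choice is integrable against
`x^(-1-α)` for `α < 1`, the second for `α > 1`. Scaling each term gives the power `α`, and `C = ∫ g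
x^(-1-α)` inherits the sign of `g`. -/
theorem integral_one_sub_exp_mul {α : ℝ} (h0 : 0 < α) (h2 : α < 2) (h1 : α ≠ 1) :
    ∃ C : ℝ, (α < 1 → 0 < C) ∧ (1 < α → C < 0) ∧ ∀ u p : ℝ, 0 ≤ u → 0 ≤ p →
      IntegrableOn (fun x => (1 - Real.exp (-(u * x))) * (1 - Real.exp (-(p * x))) *
        x ^ (-1 - α)) (Ioi 0) ∧
      ∫ x in Ioi (0 : ℝ), (1 - Real.exp (-(u * x))) * (1 - Real.exp (-(p * x))) * x ^ (-1 - α) =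
        C * (u ^ α + p ^ α - (u + p) ^ α) := by
  have key : ∀ g : ℝ → ℝ, g 0 = 0 → IntegrableOn (fun x => g x * x ^ (-1 - α)) (Ioi 0) →
      (∀ x y, (1 - Real.exp (-x)) * (1 - Real.exp (-y)) = g x + g y - g (x + y)) →
      ∀ u p : ℝ, 0 ≤ u → 0 ≤ p →
      IntegrableOn (fun x => (1 - Real.exp (-(u * x))) * (1 - Real.exp (-(p * x))) *
        x ^ (-1 - α)) (Ioi 0) ∧
      ∫ x in Ioi (0 : ℝ), (1 - Real.exp (-(u * x))) * (1 - Real.exp (-(p * x))) * x ^ (-1 - α) =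
        (∫ x in Ioi (0 : ℝ), g x * x ^ (-1 - α)) * (u ^ α + p ^ α - (u + p) ^ α) := by
    intro g g0 hg hadd u p hu hp
    have hup := add_nonneg hu hp
    have iu := integrableOn_comp_mul_rpow g0 hg hu
    have ip := integrableOn_comp_mul_rpow g0 hg hp
    have iup := integrableOn_comp_mul_rpow g0 hg hup
    have e : ∀ x, (1 - Real.exp (-(u * x))) * (1 - Real.exp (-(p * x))) * x ^ (-1 - α) =
        g (u * x) * x ^ (-1 - α) + g (p * x) * x ^ (-1 - α) -
          g ((u + p) * x) * x ^ (-1 - α) := fun x => by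
      rw [hadd, add_mul u p x]; ring
    simp only [e]
    have iuip : IntegrableOn (fun x => g (u * x) * x ^ (-1 - α) + g (p * x) * x ^ (-1 - α))
      (Ioi 0) := iu.add ip
    refine ⟨iuip.sub iup, ?_⟩
    rw [integral_sub iuip iup, integral_add iu ip, integral_comp_mul_rpow h0.ne' g0 hu,
      integral_comp_mul_rpow h0.ne' g0 hp, integral_comp_mul_rpow h0.ne' g0 hup]
    ring
  rcases h1.lt_or_gt with h1 | h1
  · have hi : IntegrableOn (fun x : ℝ => (1 - Real.exp (-x)) * x ^ (-1 - α)) (Ioi 0) := by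
      refine integrableOn_Ioi_of_rpow_bounds (A := 1) (B := 1) (p := -α) (q := -1 - α)
        (by fun_prop) (by linarith) (by linarith) (fun x hx => ?_) (fun x hx => ?_)
      · have hw := Real.rpow_nonneg hx.1.le (-1 - α)
        have e1 : Real.exp (-x) ≤ 1 := Real.exp_le_one_iff.2 (by linarith [hx.1])
        have e2 := Real.add_one_le_exp (-x)
        rw [abs_of_nonneg (mul_nonneg (by linarith) hw), one_mul,
          show -α = 1 + (-1 - α) by ring, Real.rpow_add hx.1, Real.rpow_one]
        exact mul_le_mul_of_nonneg_right (by linarith) hw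
      · have hx0 : (0 : ℝ) < x := one_pos.trans hx
        have hw := Real.rpow_nonneg hx0.le (-1 - α)
        have e1 : Real.exp (-x) ≤ 1 := Real.exp_le_one_iff.2 (by linarith)
        rw [abs_of_nonneg (mul_nonneg (by linarith) hw)]
        exact mul_le_mul_of_nonneg_right (by linarith [Real.exp_pos (-x)]) hw
    refine ⟨∫ x in Ioi (0 : ℝ), (1 - Real.exp (-x)) * x ^ (-1 - α), fun _ => ?_,
      fun h => absurd h h1.not_gt, key (fun x => 1 - Real.exp (-x)) (by simp) hi fun x y => ?_⟩
    · have hpos : ∀ x ∈ Ioi (0 : ℝ), 0 < (1 - Real.exp (-x)) * x ^ (-1 - α) := fun x hx => by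
        have : Real.exp (-x) < 1 := Real.exp_lt_one_iff.2 (by linarith [mem_Ioi.1 hx])
        exact mul_pos (by linarith) (Real.rpow_pos_of_pos hx _)
      exact setIntegral_Ioi_pos hi (fun x hx => (hpos x hx).le) fun x hx => hpos x hx.1
    · rw [neg_add, Real.exp_add]; ring
  · have hlt : ∀ x : ℝ, 0 < x → 0 < x - (1 - Real.exp (-x)) := fun x hx => by
      linarith [Real.add_one_lt_exp (neg_ne_zero.2 hx.ne')]
    have hi : IntegrableOn (fun x : ℝ => (1 - Real.exp (-x) - x) * x ^ (-1 - α)) (Ioi 0) := by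
      refine integrableOn_Ioi_of_rpow_bounds (A := 1) (B := 1) (p := 1 - α) (q := -α)
        (by fun_prop) (by linarith) (by linarith) (fun x hx => ?_) (fun x hx => ?_)
      · have hw := Real.rpow_nonneg hx.1.le (-1 - α)
        have e := Real.abs_exp_sub_one_sub_id_le (x := -x)
          (by rw [abs_neg, abs_of_pos hx.1]; exact hx.2)
        rw [abs_mul, abs_of_nonneg hw, one_mul, show 1 - α = 2 + (-1 - α) by ring,
          Real.rpow_add hx.1, Real.rpow_two]
        refine mul_le_mul_of_nonneg_right ?_ hw
        rw [neg_sq] at e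
        rwa [← abs_neg, show -(1 - Real.exp (-x) - x) = Real.exp (-x) - 1 - -x by ring]
      · have hx0 : (0 : ℝ) < x := one_pos.trans hx
        have hw := Real.rpow_nonneg hx0.le (-1 - α)
        have e1 : Real.exp (-x) ≤ 1 := Real.exp_le_one_iff.2 (by linarith)
        rw [abs_mul, abs_of_nonneg hw, one_mul, show -α = 1 + (-1 - α) by ring,
          Real.rpow_add hx0, Real.rpow_one]
        refine mul_le_mul_of_nonneg_right ?_ hw
        rw [abs_le]
        constructor <;> linarith [hlt x hx0]
    refine ⟨∫ x in Ioi (0 : ℝ), (1 - Real.exp (-x) - x) * x ^ (-1 - α),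
      fun h => absurd h h1.not_gt, fun _ => ?_,
      key (fun x => 1 - Real.exp (-x) - x) (by simp) hi fun x y => ?_⟩
    · have hpos : ∀ x ∈ Ioi (0 : ℝ), 0 < -((1 - Real.exp (-x) - x) * x ^ (-1 - α)) :=
        fun x hx => by
          rw [← neg_mul]
          exact mul_pos (by linarith [hlt x hx]) (Real.rpow_pos_of_pos hx _)
      have := setIntegral_Ioi_pos hi.neg (fun x hx => (hpos x hx).le) fun x hx => hpos x hx.1
      simp only [Pi.neg_apply, integral_neg] at this
      linarith
    · rw [neg_add, Real.exp_add]; ring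

/-- The addition formulas express both products through `1 - cos` at `u`, `v`, `u + v` and `|u -
v|`, so one constant `D = ∫ (1 - cos x) x^(-1-α)` serves both. The sine form is the difference of
`fracCov` and `fracCrossCov`, the cosine form their sum. -/
theorem integral_sin_mul_sin {α : ℝ} (h0 : 0 < α) (h2 : α < 2) :
    ∃ D : ℝ, 0 < D ∧ ∀ u v : ℝ, 0 ≤ u → 0 ≤ v →
      (IntegrableOn (fun x => Real.sin (u * x) * Real.sin (v * x) * x ^ (-1 - α)) (Ioi 0) ∧
      ∫ x in Ioi (0 : ℝ), Real.sin (u * x) * Real.sin (v * x) * x ^ (-1 - α) =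
        D * (((u + v) ^ α - |u - v| ^ α) / 2)) ∧
      (IntegrableOn (fun x => (1 - Real.cos (u * x)) * (1 - Real.cos (v * x)) * x ^ (-1 - α))
        (Ioi 0) ∧
      ∫ x in Ioi (0 : ℝ), (1 - Real.cos (u * x)) * (1 - Real.cos (v * x)) * x ^ (-1 - α) =
        D * (u ^ α + v ^ α - |u - v| ^ α / 2 - (u + v) ^ α / 2)) := by
  have hi : IntegrableOn (fun x : ℝ => (1 - Real.cos x) * x ^ (-1 - α)) (Ioi 0) := by
    refine integrableOn_Ioi_of_rpow_bounds (A := 1) (B := 2) (p := 1 - α) (q := -1 - α)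
      (by fun_prop) (by linarith) (by linarith) (fun x hx => ?_) (fun x hx => ?_)
    · have hw := Real.rpow_nonneg hx.1.le (-1 - α)
      have e := Real.one_sub_sq_div_two_le_cos (x := x)
      rw [abs_of_nonneg (mul_nonneg (by linarith [Real.cos_le_one x]) hw), one_mul,
        show 1 - α = 2 + (-1 - α) by ring, Real.rpow_add hx.1, Real.rpow_two]
      exact mul_le_mul_of_nonneg_right (by nlinarith) hw
    · have hx0 : (0 : ℝ) < x := one_pos.trans hx
      have hw := Real.rpow_nonneg hx0.le (-1 - α)
      rw [abs_of_nonneg (mul_nonneg (by linarith [Real.cos_le_one x]) hw)]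
      exact mul_le_mul_of_nonneg_right (by linarith [Real.neg_one_le_cos x]) hw
  have g0 : (fun x => 1 - Real.cos x) 0 = 0 := by simp
  refine ⟨∫ x in Ioi (0 : ℝ), (1 - Real.cos x) * x ^ (-1 - α), ?_, fun u v hu hv => ?_⟩
  · refine setIntegral_Ioi_pos hi (fun x hx => mul_nonneg (by linarith [Real.cos_le_one x])
      (Real.rpow_nonneg (mem_Ioi.1 hx).le _)) fun x hx => ?_
    have : Real.cos x < 1 := by
      rw [← Real.cos_zero]
      exact Real.cos_lt_cos_of_nonneg_of_le_pi le_rfl (by linarith [hx.2, Real.pi_gt_three]) hx.1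
    exact mul_pos (by linarith) (Real.rpow_pos_of_pos hx.1 _)
  have huv := add_nonneg hu hv
  have huv' := abs_nonneg (u - v)
  have iu := integrableOn_comp_mul_rpow (g := fun x => 1 - Real.cos x) g0 hi hu
  have iv := integrableOn_comp_mul_rpow (g := fun x => 1 - Real.cos x) g0 hi hv
  have ia := integrableOn_comp_mul_rpow (g := fun x => 1 - Real.cos x) g0 hi huv
  have is := integrableOn_comp_mul_rpow (g := fun x => 1 - Real.cos x) g0 hi huv'
  have ju := integral_comp_mul_rpow (g := fun x => 1 - Real.cos x) h0.ne' g0 hu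
  have jv := integral_comp_mul_rpow (g := fun x => 1 - Real.cos x) h0.ne' g0 hv
  have ja := integral_comp_mul_rpow (g := fun x => 1 - Real.cos x) h0.ne' g0 huv
  have js := integral_comp_mul_rpow (g := fun x => 1 - Real.cos x) h0.ne' g0 huv'
  have habs : ∀ x, Real.cos (|u - v| * x) = Real.cos (u * x - v * x) := fun x => by
    rw [← sub_mul, ← Real.cos_abs, abs_mul, abs_abs, ← abs_mul, Real.cos_abs]
  constructor
  · have e : ∀ x, Real.sin (u * x) * Real.sin (v * x) * x ^ (-1 - α) =
        1 / 2 * ((1 - Real.cos ((u + v) * x)) * x ^ (-1 - α) -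
          (1 - Real.cos (|u - v| * x)) * x ^ (-1 - α)) := fun x => by
      rw [habs, add_mul, Real.cos_add, Real.cos_sub]; ring
    simp only [e]
    refine ⟨(ia.sub is).const_mul _, ?_⟩
    rw [integral_const_mul, integral_sub ia is, ja, js]
    ring
  · have e : ∀ x, (1 - Real.cos (u * x)) * (1 - Real.cos (v * x)) * x ^ (-1 - α) =
        (1 - Real.cos (u * x)) * x ^ (-1 - α) + (1 - Real.cos (v * x)) * x ^ (-1 - α) -
        1 / 2 * ((1 - Real.cos ((u + v) * x)) * x ^ (-1 - α) +
          (1 - Real.cos (|u - v| * x)) * x ^ (-1 - α)) := fun x => by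
      rw [habs, add_mul, Real.cos_add, Real.cos_sub]; ring
    simp only [e]
    have iuv : IntegrableOn (fun x => (1 - Real.cos (u * x)) * x ^ (-1 - α) +
      (1 - Real.cos (v * x)) * x ^ (-1 - α)) (Ioi 0) := iu.add iv
    have ias : IntegrableOn (fun x => 1 / 2 * ((1 - Real.cos ((u + v) * x)) * x ^ (-1 - α) +
      (1 - Real.cos (|u - v| * x)) * x ^ (-1 - α))) (Ioi 0) := (ia.add is).const_mul _
    refine ⟨iuv.sub ias, ?_⟩
    rw [integral_sub iuv ias, integral_const_mul,
      integral_add iu iv, integral_add ia is, ja, js, ju, jv]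
    ring

theorem integral_sum_mul_sum {ι κ : Type*} (s : Finset ι) (t : Finset κ) (c : ι → ℝ) (d : κ → ℝ)
    {g : ι → ℝ → ℝ} {h : κ → ℝ → ℝ} {w : ℝ → ℝ} {S : Set ℝ}
    (hi : ∀ i ∈ s, ∀ j ∈ t, IntegrableOn (fun x => g i x * h j x * w x) S) :
    IntegrableOn (fun x => (∑ i ∈ s, c i * g i x) * (∑ j ∈ t, d j * h j x) * w x) S ∧
    ∫ x in S, (∑ i ∈ s, c i * g i x) * (∑ j ∈ t, d j * h j x) * w x =
      ∑ i ∈ s, ∑ j ∈ t, c i * d j * ∫ x in S, g i x * h j x * w x := by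
  have e : (fun x => (∑ i ∈ s, c i * g i x) * (∑ j ∈ t, d j * h j x) * w x) =
      fun x => ∑ i ∈ s, ∑ j ∈ t, c i * d j * (g i x * h j x * w x) := by
    funext x
    rw [Finset.sum_mul_sum, Finset.sum_mul]
    refine Finset.sum_congr rfl fun i _ => ?_
    rw [Finset.sum_mul]
    exact Finset.sum_congr rfl fun j _ => by ring
  have hi' : ∀ i ∈ s, ∀ j ∈ t,
      Integrable (fun x => c i * d j * (g i x * h j x * w x)) (volume.restrict S) :=
    fun i his j hj => (hi i his j hj).const_mul _
  rw [e]
  refine ⟨integrable_finsetSum _ fun i his => integrable_finsetSum _ fun j hj => hi' i his j hj, ?_⟩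
  rw [integral_finsetSum _ fun i his => integrable_finsetSum _ fun j hj => hi' i his j hj]
  refine Finset.sum_congr rfl fun i his => ?_
  rw [integral_finsetSum _ fun j hj => hi' i his j hj]
  exact Finset.sum_congr rfl fun j _ => integral_const_mul _ _

/-! ### The angle between the past and the future of fractional Brownian motion -/

theorem setLIntegral_ofReal_eq_const_mul {f g : ℝ → ℝ} (hg : Measurable g) {a : ℝ} (ha : 0 ≤ a)
    (h : ∀ x ∈ Ioi (0 : ℝ), f x = a * g x) :
    ∫⁻ x in Ioi (0 : ℝ), ENNReal.ofReal (f x) =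
      ENNReal.ofReal a * ∫⁻ x in Ioi (0 : ℝ), ENNReal.ofReal (g x) := by
  rw [← lintegral_const_mul _ hg.ennreal_ofReal]
  refine setLIntegral_congr_fun measurableSet_Ioi fun x hx => ?_
  simp only [h x hx, ENNReal.ofReal_mul ha]

theorem integral_rpow_div_nonneg (s : ℝ) : 0 ≤ ∫ x in Ioi (0 : ℝ), x ^ s / (x ^ 2 + 1) :=
  setIntegral_nonneg measurableSet_Ioi fun x hx =>
    div_nonneg (Real.rpow_nonneg (mem_Ioi.1 hx).le s) (by positivity)

/-- The Laplace energy of a combination of one-sided increments is dominated by its sine energy. -/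
theorem laplace_le_sin {α : ℝ} (h0 : 0 < α) (h2 : α < 2) :
    ∃ K : ℝ, 0 ≤ K ∧ ∀ (ι : Type) (s : Finset ι) (c u : ι → ℝ), (∀ i, 0 ≤ u i) →
      IntegrableOn (fun x => (∑ i ∈ s, c i * Real.sin (u i * x)) ^ 2 * x ^ (-1 - α)) (Ioi 0) →
      IntegrableOn (fun x => (∑ i ∈ s, c i * (1 - Real.exp (-(u i * x)))) ^ 2 * x ^ (-1 - α))
        (Ioi 0) →
      ∫ x in Ioi (0 : ℝ), (∑ i ∈ s, c i * (1 - Real.exp (-(u i * x)))) ^ 2 * x ^ (-1 - α) ≤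
        K * ∫ x in Ioi (0 : ℝ), (∑ i ∈ s, c i * Real.sin (u i * x)) ^ 2 * x ^ (-1 - α) := by
  set J : ℝ → ℝ := fun s => ∫ x in Ioi (0 : ℝ), x ^ s / (x ^ 2 + 1) with hJ
  have hJ0 : ∀ s, 0 ≤ J s := integral_rpow_div_nonneg
  refine ⟨(2 / Real.pi) ^ 2 * (J (α / 2 - 1) * J (1 - α / 2)), by
    have := hJ0 (α / 2 - 1); have := hJ0 (1 - α / 2); positivity, fun ι s c u hu hS hL => ?_⟩
  -- With the weight exponent `α / 2`, both Schur integrals reduce to `J` at exponents in `(-1, 1)`.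
  -- By `integral_sin_mul_div` the kernel maps the sine sum to `π / 2` times the Laplace sum, whence
  -- the factor `(2 / π)²` in `K`.
  have hk := integral_sq_kernel_le (k := fun l x => l ^ 2 / (x * (x ^ 2 + l ^ 2)))
    (by fun_prop)
    (fun l hl x hx => by
      have : 0 < x := hx
      positivity)
    (α / 2) (-1 - α) (C₁ := J (α / 2 - 1)) (C₂ := J (1 - α / 2))
    (fun l hl => by
      have hl0 : 0 < l := hl
      rw [setLIntegral_ofReal_eq_const_mul (a := l ^ 2)
        (g := fun x => x ^ (α / 2 - 1) / (x ^ 2 + l ^ 2)) (by fun_prop) (by positivity)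
        (fun x hx => by
          rw [Real.rpow_sub hx, Real.rpow_one]
          field_simp),
        lintegral_rpow_div_sq_add_sq (by linarith) (by linarith) hl,
        ← ENNReal.ofReal_mul (by positivity), show α / 2 = 2 + (α / 2 - 1 - 1) by ring,
        Real.rpow_add hl, Real.rpow_two]
      refine le_of_eq ?_
      congr 1
      simp only [hJ]
      ring_nf)
    (fun x hx => by
      have hx0 : 0 < x := hx
      rw [setLIntegral_ofReal_eq_const_mul (a := x⁻¹)
        (g := fun l => l ^ (1 - α / 2) / (l ^ 2 + x ^ 2)) (by fun_prop) (by positivity)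
        (fun l hl => by
          rw [show 1 - α / 2 = 2 + (-1 - α + α / 2) by ring, Real.rpow_add hl 2, Real.rpow_two]
          field_simp
          ring),
        lintegral_rpow_div_sq_add_sq (by linarith) (by linarith) hx,
        ← ENNReal.ofReal_mul (by positivity),
        show -1 - α + α / 2 = -1 + (1 - α / 2 - 1) by ring, Real.rpow_add hx, Real.rpow_neg_one]
      refine le_of_eq ?_
      congr 1
      simp only [hJ]
      ring_nf)
    (hJ0 _) (hJ0 _) (F := fun x => ∑ i ∈ s, c i * Real.sin (u i * x))
    (G := fun l => Real.pi / 2 * ∑ i ∈ s, c i * (1 - Real.exp (-(u i * l)))) (by fun_prop) hS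
    (by
      refine (hL.const_mul ((Real.pi / 2) ^ 2)).congr ?_
      exact Eventually.of_forall fun x => by simp only; ring)
    (fun l hl => by
      have hi : ∀ i ∈ s, IntegrableOn (fun x => c i *
          (Real.sin (u i * x) * (l ^ 2 / (x * (x ^ 2 + l ^ 2))))) (Ioi 0) := fun i _ => by
        refine Integrable.const_mul ?_ _
        have := (integrableOn_div_sq_add_sq hl).const_mul (l * u i)
        refine this.mono' (by fun_prop) (ae_restrict_of_forall_mem measurableSet_Ioi fun x hx => ?_)
        have hx0 : 0 < x := hx
        have hl0 : 0 < l := hl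
        have hsin : |Real.sin (u i * x)| ≤ u i * x :=
          Real.abs_sin_le_abs.trans_eq (abs_of_nonneg (mul_nonneg (hu i) hx0.le))
        rw [Real.norm_eq_abs, abs_mul, abs_of_pos (a := l ^ 2 / _) (by positivity)]
        calc _ ≤ u i * x * (l ^ 2 / (x * (x ^ 2 + l ^ 2))) := by gcongr
          _ = _ := by field_simp
      simp only [Finset.sum_mul, mul_assoc]
      rw [integral_finsetSum _ hi, Finset.mul_sum]
      refine Finset.sum_congr rfl fun i _ => ?_
      rw [integral_const_mul, integral_sin_mul_div (hu i) hl]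
      ring)
  have e : ∀ x : ℝ, (Real.pi / 2 * ∑ i ∈ s, c i * (1 - Real.exp (-(u i * x)))) ^ 2 * x ^ (-1 - α) =
      (Real.pi / 2) ^ 2 *
        ((∑ i ∈ s, c i * (1 - Real.exp (-(u i * x)))) ^ 2 * x ^ (-1 - α)) := fun x => by ring
  simp only [e, integral_const_mul] at hk
  have hpi := Real.pi_pos
  calc _ = (2 / Real.pi) ^ 2 * ((Real.pi / 2) ^ 2 * ∫ x in Ioi (0 : ℝ),
        (∑ i ∈ s, c i * (1 - Real.exp (-(u i * x)))) ^ 2 * x ^ (-1 - α)) := by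
        field_simp
    _ ≤ _ := by
        rw [mul_assoc]
        gcongr

/-- The Laplace energy of a combination of one-sided increments is dominated by its cosine
energy. -/
theorem laplace_le_cos {α : ℝ} (h0 : 0 < α) (h2 : α < 2) :
    ∃ K : ℝ, 0 ≤ K ∧ ∀ (ι : Type) (s : Finset ι) (c u : ι → ℝ), (∀ i, 0 ≤ u i) →
      IntegrableOn (fun x => (∑ i ∈ s, c i * (1 - Real.cos (u i * x))) ^ 2 * x ^ (-1 - α))
        (Ioi 0) →
      IntegrableOn (fun x => (∑ i ∈ s, c i * (1 - Real.exp (-(u i * x)))) ^ 2 * x ^ (-1 - α))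
        (Ioi 0) →
      ∫ x in Ioi (0 : ℝ), (∑ i ∈ s, c i * (1 - Real.exp (-(u i * x)))) ^ 2 * x ^ (-1 - α) ≤
        K * ∫ x in Ioi (0 : ℝ), (∑ i ∈ s, c i * (1 - Real.cos (u i * x))) ^ 2 * x ^ (-1 - α) := by
  set J : ℝ → ℝ := fun s => ∫ x in Ioi (0 : ℝ), x ^ s / (x ^ 2 + 1) with hJ
  have hJ0 : ∀ s, 0 ≤ J s := integral_rpow_div_nonneg
  refine ⟨(2 / Real.pi) ^ 2 * (J (α / 2) * J (-(α / 2))), by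
    have := hJ0 (α / 2); have := hJ0 (-(α / 2)); positivity, fun ι s c u hu hS hL => ?_⟩
  -- The same weight exponent works; the `J` exponents are now `±α / 2`, which lie in `(-1, 1)`
  -- because `α < 2`.
  have hk := integral_sq_kernel_le (k := fun l x => l / (x ^ 2 + l ^ 2))
    (by fun_prop)
    (fun l hl x hx => div_nonneg (mem_Ioi.1 hl).le (by positivity))
    (α / 2) (-1 - α) (C₁ := J (α / 2)) (C₂ := J (-(α / 2)))
    (fun l hl => by
      have hl0 : 0 < l := hl
      rw [setLIntegral_ofReal_eq_const_mul (a := l)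
        (g := fun x => x ^ (α / 2) / (x ^ 2 + l ^ 2)) (by fun_prop) hl0.le
        (fun x hx => by ring),
        lintegral_rpow_div_sq_add_sq (by linarith) (by linarith) hl,
        ← ENNReal.ofReal_mul hl0.le]
      refine le_of_eq ?_
      congr 1
      rw [Real.rpow_sub hl, Real.rpow_one]
      field_simp
      rfl)
    (fun x hx => by
      have hx0 : 0 < x := hx
      rw [setLIntegral_ofReal_eq_const_mul (a := 1)
        (g := fun l => l ^ (-(α / 2)) / (l ^ 2 + x ^ 2)) (by fun_prop) zero_le_one
        (fun l hl => by
          rw [show -(α / 2) = 1 + (-1 - α + α / 2) by ring, Real.rpow_add hl 1, Real.rpow_one]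
          field_simp
          ring),
        lintegral_rpow_div_sq_add_sq (by linarith) (by linarith) hx,
        ENNReal.ofReal_one, one_mul]
      refine le_of_eq ?_
      congr 1
      simp only [hJ]
      ring_nf)
    (hJ0 _) (hJ0 _) (F := fun x => ∑ i ∈ s, c i * (1 - Real.cos (u i * x)))
    (G := fun l => Real.pi / 2 * ∑ i ∈ s, c i * (1 - Real.exp (-(u i * l)))) (by fun_prop) hS
    (by
      refine (hL.const_mul ((Real.pi / 2) ^ 2)).congr ?_
      exact Eventually.of_forall fun x => by simp only; ring)
    (fun l hl => by
      have hi : ∀ i ∈ s, IntegrableOn (fun x => c i *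
          ((1 - Real.cos (u i * x)) * (l / (x ^ 2 + l ^ 2)))) (Ioi 0) := fun i _ => by
        refine Integrable.const_mul ?_ _
        refine (integrableOn_div_sq_add_sq hl).bdd_mul (c := 2) (by fun_prop)
          (Eventually.of_forall fun x => ?_)
        rw [Real.norm_eq_abs, abs_le]
        constructor <;> linarith [Real.cos_le_one (u i * x), Real.neg_one_le_cos (u i * x)]
      simp only [Finset.sum_mul, mul_assoc]
      rw [integral_finsetSum _ hi, Finset.mul_sum]
      refine Finset.sum_congr rfl fun i _ => ?_
      rw [integral_const_mul, integral_one_sub_cos_mul_div (hu i) hl]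
      ring)
  have e : ∀ x : ℝ, (Real.pi / 2 * ∑ i ∈ s, c i * (1 - Real.exp (-(u i * x)))) ^ 2 * x ^ (-1 - α) =
      (Real.pi / 2) ^ 2 *
        ((∑ i ∈ s, c i * (1 - Real.exp (-(u i * x)))) ^ 2 * x ^ (-1 - α)) := fun x => by ring
  simp only [e, integral_const_mul] at hk
  have hpi := Real.pi_pos
  calc _ = (2 / Real.pi) ^ 2 * ((Real.pi / 2) ^ 2 * ∫ x in Ioi (0 : ℝ),
        (∑ i ∈ s, c i * (1 - Real.exp (-(u i * x)))) ^ 2 * x ^ (-1 - α)) := by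
        field_simp
    _ ≤ _ := by
        rw [mul_assoc]
        gcongr

/-- Covariance of two increments of a fractional Brownian motion with common starting point and
lengths `u`, `v`, pointing in the same direction. -/
def fracCov (α u v : ℝ) : ℝ := 1 / 2 * (u ^ α + v ^ α - |u - v| ^ α)

/-- Covariance of two increments of a fractional Brownian motion with common starting point and
lengths `u`, `p`, pointing in opposite directions. -/
def fracCrossCov (α u p : ℝ) : ℝ := 1 / 2 * (u ^ α + p ^ α - (u + p) ^ α)

/-- The Laplace transform of a combination of one-sided increments of lengths `u i`, up to the
factor `x`. -/
def laplaceSum {ι : Type} (s : Finset ι) (c u : ι → ℝ) (x : ℝ) : ℝ :=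
  ∑ i ∈ s, c i * (1 - Real.exp (-(u i * x)))

/-- The squared norm of `laplaceSum` in the weighted space `L²(x ^ (-1 - α) dx)`. -/
def laplaceEnergy (α : ℝ) {ι : Type} (s : Finset ι) (c u : ι → ℝ) : ℝ :=
  ∫ x in Ioi (0 : ℝ), laplaceSum s c u x ^ 2 * x ^ (-1 - α)

/-- Past and future of a fractional Brownian motion form a positive angle. -/
theorem fracCrossCov_le {α : ℝ} (h0 : 0 < α) (h2 : α < 2) :
    ∃ ρ : ℝ, 0 ≤ ρ ∧ ρ < 1 ∧ ∀ (ι κ : Type) (s : Finset ι) (t : Finset κ) (c u : ι → ℝ)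
      (d p : κ → ℝ), (∀ i, 0 ≤ u i) → (∀ j, 0 ≤ p j) →
      -(2 * ∑ i ∈ s, ∑ j ∈ t, c i * d j * fracCrossCov α (u i) (p j)) ≤
        ρ * ((∑ i ∈ s, ∑ j ∈ s, c i * c j * fracCov α (u i) (u j)) +
          ∑ i ∈ t, ∑ j ∈ t, d i * d j * fracCov α (p i) (p j)) := by
  -- For Brownian motion the cross covariance vanishes identically.
  by_cases h1 : α = 1
  · refine ⟨0, le_rfl, zero_lt_one, fun ι κ s t c u d p _ _ => ?_⟩
    simp [fracCrossCov, h1]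
  obtain ⟨C, hClt, hCgt, hC⟩ := integral_one_sub_exp_mul h0 h2 h1
  obtain ⟨D, hD0, hD⟩ := integral_sin_mul_sin h0 h2
  have hC0 : 0 < |C| := by
    rcases lt_or_gt_of_ne h1 with h | h
    · exact abs_pos.2 (hClt h).ne'
    · exact abs_pos.2 (hCgt h).ne
  have hLL : ∀ (ι κ : Type) (s : Finset ι) (t : Finset κ) (c u : ι → ℝ)
      (d p : κ → ℝ), (∀ i, 0 ≤ u i) → (∀ j, 0 ≤ p j) →
      IntegrableOn (fun x => laplaceSum s c u x * laplaceSum t d p x * x ^ (-1 - α)) (Ioi 0) ∧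
      ∫ x in Ioi (0 : ℝ), laplaceSum s c u x * laplaceSum t d p x * x ^ (-1 - α) =
        2 * C * ∑ i ∈ s, ∑ j ∈ t, c i * d j * fracCrossCov α (u i) (p j) := by
    intro ι κ s t c u d p hu hp
    have h := integral_sum_mul_sum s t c d (g := fun i x => 1 - Real.exp (-(u i * x)))
      (h := fun j x => 1 - Real.exp (-(p j * x))) (w := fun x => x ^ (-1 - α)) (S := Ioi 0)
      (fun i _ j _ => (hC _ _ (hu i) (hp j)).1)
    refine ⟨h.1, h.2.trans ?_⟩
    simp only [Finset.mul_sum]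
    refine Finset.sum_congr rfl fun i _ => Finset.sum_congr rfl fun j _ => ?_
    rw [(hC _ _ (hu i) (hp j)).2, fracCrossCov]
    ring
  have hLi : ∀ (ι : Type) (s : Finset ι) (c u : ι → ℝ), (∀ i, 0 ≤ u i) →
      IntegrableOn (fun x => laplaceSum s c u x ^ 2 * x ^ (-1 - α)) (Ioi 0) := by
    intro ι s c u hu
    simpa only [sq] using (hLL ι ι s s c u c u hu hu).1
  -- The sign of `C` decides the case: `laplaceEnergy / (2|C|)` is the quadratic form of
  -- `fracCrossCov` if `α < 1` and its negative if `α > 1`. Subtracting it from the form of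
  -- `fracCov` leaves the sine energy or the cosine energy, divided by `D`.
  have hmain : ∃ M : ℝ, 0 ≤ M ∧ ∀ (ι : Type) (s : Finset ι) (c u : ι → ℝ), (∀ i, 0 ≤ u i) →
      laplaceEnergy α s c u / (2 * |C|) ≤ M * ((∑ i ∈ s, ∑ j ∈ s, c i * c j * fracCov α (u i) (u j)) -
        laplaceEnergy α s c u / (2 * |C|)) := by
    rcases lt_or_gt_of_ne h1 with h | h
    · obtain ⟨K, hK0, hK⟩ := laplace_le_sin h0 h2
      refine ⟨K * D / (2 * |C|), by positivity, fun ι s c u hu => ?_⟩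
      have hS := integral_sum_mul_sum s s c c (g := fun i x => Real.sin (u i * x))
        (h := fun i x => Real.sin (u i * x)) (w := fun x => x ^ (-1 - α)) (S := Ioi 0)
        (fun i _ j _ => (hD _ _ (hu i) (hu j)).1.1)
      simp only [← sq] at hS
      have hE : laplaceEnergy α s c u / (2 * |C|) =
          ∑ i ∈ s, ∑ j ∈ s, c i * c j * fracCrossCov α (u i) (u j) := by
        have := (hLL ι ι s s c u c u hu hu).2
        simp only [← sq] at this
        rw [laplaceEnergy]
        rw [this, abs_of_pos (hClt h)]
        have := (hClt h).ne'
        field_simp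
      have hS2 : ∫ x in Ioi (0 : ℝ), (∑ i ∈ s, c i * Real.sin (u i * x)) ^ 2 * x ^ (-1 - α) =
          D * ((∑ i ∈ s, ∑ j ∈ s, c i * c j * fracCov α (u i) (u j)) - laplaceEnergy α s c u / (2 * |C|)) := by
        rw [hS.2, hE, ← Finset.sum_sub_distrib, Finset.mul_sum]
        refine Finset.sum_congr rfl fun i _ => ?_
        rw [← Finset.sum_sub_distrib, Finset.mul_sum]
        refine Finset.sum_congr rfl fun j _ => ?_
        rw [(hD _ _ (hu i) (hu j)).1.2, fracCov, fracCrossCov]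
        ring
      have := hK ι s c u hu hS.1 (hLi ι s c u hu)
      rw [hS2] at this
      rw [div_mul_eq_mul_div, mul_assoc]
      exact div_le_div_of_nonneg_right this (by positivity)
    · obtain ⟨K, hK0, hK⟩ := laplace_le_cos h0 h2
      refine ⟨K * D / (2 * |C|), by positivity, fun ι s c u hu => ?_⟩
      have hS := integral_sum_mul_sum s s c c (g := fun i x => 1 - Real.cos (u i * x))
        (h := fun i x => 1 - Real.cos (u i * x)) (w := fun x => x ^ (-1 - α)) (S := Ioi 0)
        (fun i _ j _ => (hD _ _ (hu i) (hu j)).2.1)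
      simp only [← sq] at hS
      have hE : laplaceEnergy α s c u / (2 * |C|) =
          -∑ i ∈ s, ∑ j ∈ s, c i * c j * fracCrossCov α (u i) (u j) := by
        have := (hLL ι ι s s c u c u hu hu).2
        simp only [← sq] at this
        rw [laplaceEnergy]
        rw [this, abs_of_neg (hCgt h)]
        have := (hCgt h).ne
        field_simp
      have hS2 : ∫ x in Ioi (0 : ℝ), (∑ i ∈ s, c i * (1 - Real.cos (u i * x))) ^ 2 *
          x ^ (-1 - α) =
          D * ((∑ i ∈ s, ∑ j ∈ s, c i * c j * fracCov α (u i) (u j)) - laplaceEnergy α s c u / (2 * |C|)) := by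
        rw [hS.2, hE, sub_neg_eq_add, ← Finset.sum_add_distrib, Finset.mul_sum]
        refine Finset.sum_congr rfl fun i _ => ?_
        rw [← Finset.sum_add_distrib, Finset.mul_sum]
        refine Finset.sum_congr rfl fun j _ => ?_
        rw [(hD _ _ (hu i) (hu j)).2.2, fracCov, fracCrossCov]
        ring
      have := hK ι s c u hu hS.1 (hLi ι s c u hu)
      rw [hS2] at this
      rw [div_mul_eq_mul_div, mul_assoc]
      exact div_le_div_of_nonneg_right this (by positivity)
  obtain ⟨M, hM0, hM⟩ := hmain
  -- Solving `e ≤ M (Q - e)` for `e` gives `e ≤ M / (1 + M) * Q`, with a factor strictly below 1.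
  refine ⟨M / (1 + M), by positivity, (div_lt_one (by positivity)).2 (by linarith),
    fun ι κ s t c u d p hu hp => ?_⟩
  have hM' : ∀ (ι : Type) (s : Finset ι) (c u : ι → ℝ), (∀ i, 0 ≤ u i) →
      laplaceEnergy α s c u / (2 * |C|) ≤ M / (1 + M) * ∑ i ∈ s, ∑ j ∈ s, c i * c j * fracCov α (u i) (u j) := by
    intro ι s c u hu
    rw [div_mul_eq_mul_div, le_div_iff₀ (by positivity)]
    linarith [hM ι s c u hu]
  have hcs : |2 * ∫ x in Ioi (0 : ℝ), laplaceSum s c u x * laplaceSum t d p x * x ^ (-1 - α)| ≤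
      laplaceEnergy α s c u + laplaceEnergy α t d p := by
    rw [laplaceEnergy, laplaceEnergy]
    rw [← integral_add (hLi ι s c u hu) (hLi κ t d p hp), ← integral_const_mul]
    refine (abs_integral_le_integral_abs).trans ?_
    refine setIntegral_mono_on ((hLL ι κ s t c u d p hu hp).1.const_mul 2).abs
      ((hLi ι s c u hu).add (hLi κ t d p hp)) measurableSet_Ioi fun x hx => ?_
    have hw := Real.rpow_nonneg (mem_Ioi.1 hx).le (-1 - α)
    rw [← mul_assoc, abs_mul, abs_of_nonneg hw, ← add_mul]
    refine mul_le_mul_of_nonneg_right (abs_le.2 ⟨?_, ?_⟩) hw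
    · nlinarith [sq_nonneg (laplaceSum s c u x + laplaceSum t d p x)]
    · nlinarith [sq_nonneg (laplaceSum s c u x - laplaceSum t d p x)]
  rw [(hLL ι κ s t c u d p hu hp).2] at hcs
  calc -(2 * ∑ i ∈ s, ∑ j ∈ t, c i * d j * fracCrossCov α (u i) (p j))
      ≤ |2 * ∑ i ∈ s, ∑ j ∈ t, c i * d j * fracCrossCov α (u i) (p j)| := neg_le_abs _
    _ = |2 * (2 * C * ∑ i ∈ s, ∑ j ∈ t, c i * d j * fracCrossCov α (u i) (p j))| / (2 * |C|) := by
      simp only [abs_mul, abs_two]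
      field_simp
    _ ≤ (laplaceEnergy α s c u + laplaceEnergy α t d p) / (2 * |C|) := div_le_div_of_nonneg_right hcs (by positivity)
    _ ≤ _ := by
      rw [add_div, mul_add]
      exact add_le_add (hM' ι s c u hu) (hM' κ t d p hp)

/-- A bound for oblique projections along vectors with the Gram matrix of fractional increments. -/
theorem norm_le_norm_add_of_fracCov {α : ℝ} (h0 : 0 < α) (h2 : α < 2) :
    ∃ K : ℝ, 0 ≤ K ∧ ∀ (V : Type*) [SeminormedAddCommGroup V] [InnerProductSpace ℝ V] (ι κ : Type)
      (F : ι → V) (G : κ → V) (u : ι → ℝ) (p : κ → ℝ), (∀ i, 0 ≤ u i) → (∀ j, 0 ≤ p j) →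
      (∀ i j, inner ℝ (F i) (F j) = fracCov α (u i) (u j)) →
      (∀ i j, inner ℝ (G i) (G j) = fracCov α (p i) (p j)) →
      (∀ i j, inner ℝ (F i) (G j) = fracCrossCov α (u i) (p j)) →
      ∀ x ∈ Submodule.span ℝ (range F), ∀ y ∈ Submodule.span ℝ (range G),
        ‖y‖ ≤ K * ‖x + y‖ := by
  obtain ⟨ρ, hρ0, hρ1, hρ⟩ := fracCrossCov_le h0 h2
  refine ⟨Real.sqrt (1 / (1 - ρ)), Real.sqrt_nonneg _, ?_⟩
  intro V _ _ ι κ F G u p hu hp hF hG hFG x hx y hy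
  obtain ⟨c, rfl⟩ := (Finsupp.mem_span_range_iff_exists_finsupp).1 hx
  obtain ⟨d, rfl⟩ := (Finsupp.mem_span_range_iff_exists_finsupp).1 hy
  set x := c.sum fun i a => a • F i with hxdef
  set y := d.sum fun i a => a • G i with hydef
  have h := hρ ι κ c.support d.support c u d p hu hp
  have hxx : ‖x‖ ^ 2 = ∑ i ∈ c.support, ∑ j ∈ c.support, c i * c j * fracCov α (u i) (u j) := by
    rw [← real_inner_self_eq_norm_sq, hxdef, Finsupp.sum, sum_inner]
    refine Finset.sum_congr rfl fun i _ => ?_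
    rw [inner_sum]
    refine Finset.sum_congr rfl fun j _ => ?_
    rw [real_inner_smul_left, real_inner_smul_right, hF, mul_assoc]
  have hyy : ‖y‖ ^ 2 = ∑ i ∈ d.support, ∑ j ∈ d.support, d i * d j * fracCov α (p i) (p j) := by
    rw [← real_inner_self_eq_norm_sq, hydef, Finsupp.sum, sum_inner]
    refine Finset.sum_congr rfl fun i _ => ?_
    rw [inner_sum]
    refine Finset.sum_congr rfl fun j _ => ?_
    rw [real_inner_smul_left, real_inner_smul_right, hG, mul_assoc]
  have hxy : inner ℝ x y =
      ∑ i ∈ c.support, ∑ j ∈ d.support, c i * d j * fracCrossCov α (u i) (p j) := by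
    rw [hxdef, hydef, Finsupp.sum, Finsupp.sum, sum_inner]
    refine Finset.sum_congr rfl fun i _ => ?_
    rw [inner_sum]
    refine Finset.sum_congr rfl fun j _ => ?_
    rw [real_inner_smul_left, real_inner_smul_right, hFG, mul_assoc]
  rw [← hxx, ← hyy, ← hxy] at h
  have hadd := norm_add_sq_real x y
  -- The angle bound gives `‖x + y‖² ≥ (1 - ρ)(‖x‖² + ‖y‖²)`.
  have hle : ‖y‖ ^ 2 ≤ 1 / (1 - ρ) * ‖x + y‖ ^ 2 := by
    rw [one_div_mul_eq_div, le_div_iff₀ (by linarith)]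
    nlinarith [sq_nonneg ‖x‖]
  rw [← Real.sqrt_sq (norm_nonneg y), ← Real.sqrt_sq (norm_nonneg (x + y)), ← Real.sqrt_mul
    (by have : 0 < 1 - ρ := by linarith
        positivity)]
  exact Real.sqrt_le_sqrt hle

/-! ### Truncation of step functions -/

theorem stepFn_induction {T : ℝ} {p : StepFn T → Prop}
    (hind : ∀ t : Icc (0 : ℝ) T, p ⟨ind t, ind_mem_stepFn t⟩)
    (hzero : p 0) (hadd : ∀ f g, p f → p g → p (f + g)) (hsmul : ∀ (a : ℝ) f, p f → p (a • f))
    (f : StepFn T) : p f := by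
  obtain ⟨f, hf⟩ := f
  induction hf using Submodule.span_induction with
  | mem x h =>
    obtain ⟨t, rfl⟩ := h
    exact hind ⟨t, t.2.1.le, t.2.2⟩
  | zero => exact hzero
  | add x y hx hy h1 h2 => exact hadd ⟨x, hx⟩ ⟨y, hy⟩ h1 h2
  | smul a x hx h => exact hsmul a ⟨x, hx⟩ h

theorem stepFn_hom_ext {T : ℝ} {V : Type*} [AddCommGroup V] [Module ℝ V] {L M : StepFn T →ₗ[ℝ] V}
    (h : ∀ t : Icc (0 : ℝ) T, L ⟨ind t, ind_mem_stepFn t⟩ = M ⟨ind t, ind_mem_stepFn t⟩)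
    (f : StepFn T) : L f = M f := by
  induction f using stepFn_induction with
  | hind t => exact h t
  | hzero => simp
  | hadd f g hf hg => simp [hf, hg]
  | hsmul a f hf => simp [hf]

theorem indicator_Ioc_ind (t r : ℝ) : (Ioc 0 r).indicator (ind t) = ind (min t r) := by
  rw [ind, indicator_indicator, Ioc_inter_Ioc, ind, max_self, min_comm]

/-- Multiplication by the indicator function of a set, as a linear map. -/
def indicatorLinearMap (s : Set ℝ) : (ℝ → ℝ) →ₗ[ℝ] (ℝ → ℝ) where
  toFun := s.indicator
  map_add' := indicator_add s
  map_smul' a f := indicator_const_smul s a f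

/-- The truncation `f ↦ 1_{(0,r]} f` of step functions. -/
def truncate {T : ℝ} (r : Icc (0 : ℝ) T) : StepFn T →ₗ[ℝ] StepFn T :=
  (indicatorLinearMap (Ioc 0 (r : ℝ))).restrict fun f hf => by
    have hle : StepFn T ≤ (StepFn T).comap (indicatorLinearMap (Ioc 0 (r : ℝ))) := by
      refine Submodule.span_le.2 ?_
      rintro _ ⟨t, rfl⟩
      change (Ioc 0 (r : ℝ)).indicator (ind t) ∈ StepFn T
      rw [indicator_Ioc_ind]
      exact ind_mem_stepFn (min ⟨t, t.2.1.le, t.2.2⟩ r)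
    exact hle hf

theorem coe_truncate {T : ℝ} (r : Icc (0 : ℝ) T) (f : StepFn T) :
    (truncate r f : ℝ → ℝ) = (Ioc 0 (r : ℝ)).indicator (f : ℝ → ℝ) := rfl

theorem truncate_ind {T : ℝ} (r t : Icc (0 : ℝ) T) :
    truncate r ⟨ind t, ind_mem_stepFn t⟩ = ⟨ind ↑(min t r), ind_mem_stepFn (min t r)⟩ :=
  Subtype.ext (indicator_Ioc_ind t r)

/-! ### Reduction to a truncation bound on step functions -/

section Criterion

variable {Ω : Type*} [MeasurableSpace Ω] {P : Measure Ω} {T : ℝ} {X : Icc (0 : ℝ) T → Ω → ℝ}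

/-- `stepIntegrand` as a linear map. -/
def stepIntegrandₗ (hX : IsCenteredGaussian X P) : StepFn T →ₗ[ℝ] Integrands hX :=
  (UniformSpace.Completion.toComplL (𝕜 := ℝ) (E := PreIntegrands hX)).toLinearMap ∘ₗ
    PreIntegrands.of hX

theorem stepIntegrandₗ_apply (hX : IsCenteredGaussian X P) (f : StepFn T) :
    stepIntegrandₗ hX f = stepIntegrand hX f := rfl

theorem apply_stepIntegrand_eq_truncate (hX : IsCenteredGaussian X P) {r : Icc (0 : ℝ) T}
    {A : Integrands hX →L[ℝ] Integrands hX}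
    (hA : ∀ t : Icc (0 : ℝ) T, A (indIntegrand hX t) = indIntegrand hX (min t r)) (f : StepFn T) :
    A (stepIntegrand hX f) = stepIntegrand hX (truncate r f) := by
  refine stepFn_hom_ext (L := A.toLinearMap ∘ₗ stepIntegrandₗ hX)
    (M := stepIntegrandₗ hX ∘ₗ truncate r) (fun t => ?_) f
  simp only [LinearMap.comp_apply, truncate_ind]
  exact hA t

theorem norm_stepIntegral_truncate_le (hX : IsCenteredGaussian X P) {r : Icc (0 : ℝ) T}
    {A : Integrands hX →L[ℝ] Integrands hX}
    (hA : ∀ t : Icc (0 : ℝ) T, A (indIntegrand hX t) = indIntegrand hX (min t r)) (f : StepFn T) :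
    ‖stepIntegral hX (truncate r f)‖ ≤ ‖A‖ * ‖stepIntegral hX f‖ := by
  rw [← norm_stepIntegrand, ← norm_stepIntegrand, ← apply_stepIntegrand_eq_truncate hX hA]
  exact A.le_opNorm _

/-- The bound makes truncation continuous for the seminorm, in particular compatible with step
functions of norm zero, so it extends to the completion. -/
theorem exists_indefinite_operator (hX : IsCenteredGaussian X P) {r : Icc (0 : ℝ) T} {C : ℝ}
    (hC : ∀ f : StepFn T, ‖stepIntegral hX (truncate r f)‖ ≤ C * ‖stepIntegral hX f‖) :
    ∃ A : Integrands hX →L[ℝ] Integrands hX,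
      ∀ t : Icc (0 : ℝ) T, A (indIntegrand hX t) = indIntegrand hX (min t r) := by
  let S : PreIntegrands hX →ₗ[ℝ] Integrands hX := stepIntegrandₗ hX ∘ₗ truncate r
  let S' : PreIntegrands hX →L[ℝ] Integrands hX := S.mkContinuous C fun f => by
    refine (norm_stepIntegrand hX (truncate r f)).trans_le ?_
    exact hC f
  refine ⟨S'.extend UniformSpace.Completion.toComplL, fun t => ?_⟩
  have h := ContinuousLinearMap.extend_eq S' (e := UniformSpace.Completion.toComplL)
    UniformSpace.Completion.denseRange_coe (UniformSpace.Completion.isUniformInducing_coe _)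
    (PreIntegrands.of hX ⟨ind t, ind_mem_stepFn t⟩)
  refine h.trans ?_
  change stepIntegrand hX (truncate r ⟨ind t, ind_mem_stepFn t⟩) = _
  rw [truncate_ind]
  rfl

/-! ### Fractional Brownian motion -/

theorem IsFractionalBrownianMotion.inner_toLp {H : ℝ}
    (hX : IsFractionalBrownianMotion H X P) (t s : Icc (0 : ℝ) T) :
    inner ℝ ((hX.memLp t).toLp (X t)) ((hX.memLp s).toLp (X s)) =
      1 / 2 * ((t : ℝ) ^ (2 * H) + (s : ℝ) ^ (2 * H) - |(t : ℝ) - (s : ℝ)| ^ (2 * H)) := by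
  rw [← hX.covariance, ← inner_indIntegrand hX.toIsCenteredGaussian, ← stepIntegral_ind,
    ← stepIntegral_ind, indIntegrand, indIntegrand, stepIntegrand, stepIntegrand,
    UniformSpace.Completion.inner_coe]
  rfl

theorem IsFractionalBrownianMotion.hasIndefiniteWienerIntegral {H : ℝ} (hH : H ∈ Ioo (0 : ℝ) 1)
    (hX : IsFractionalBrownianMotion H X P) : HasIndefiniteWienerIntegral X P := by
  refine ⟨hX.toIsCenteredGaussian, fun r => ?_⟩
  obtain ⟨K, hK0, hK⟩ := norm_le_norm_add_of_fracCov (α := 2 * H) (by linarith [hH.1])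
    (by linarith [hH.2])
  refine exists_indefinite_operator hX.toIsCenteredGaussian (C := K) fun f => ?_
  let b : Icc (0 : ℝ) T → Lp ℝ 2 P := fun t => (hX.memLp t).toLp (X t)
  -- `F` holds the future increments seen from `r`, `G` the past ones. Stationarity of increments,
  -- in the form `hb2`, makes their Gram matrices depend only on the distances to `r`.
  let F : {t : Icc (0 : ℝ) T // r ≤ t} → Lp ℝ 2 P := fun t => b t - b r
  let G : {t : Icc (0 : ℝ) T // t ≤ r} → Lp ℝ 2 P := fun t => b t - b r
  have h2H : (2 * H) ≠ 0 := by linarith [hH.1]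
  have hb : ∀ t s, inner ℝ (b t) (b s) =
      1 / 2 * ((t : ℝ) ^ (2 * H) + (s : ℝ) ^ (2 * H) - |(t : ℝ) - (s : ℝ)| ^ (2 * H)) :=
    hX.inner_toLp
  have hb2 : ∀ t s, inner ℝ (b t - b r) (b s - b r) = 1 / 2 * (|(t : ℝ) - r| ^ (2 * H) +
      |(s : ℝ) - r| ^ (2 * H) - |(t : ℝ) - s| ^ (2 * H)) := fun t s => by
    rw [inner_sub_left, inner_sub_right, inner_sub_right, hb, hb, hb, hb, sub_self, abs_zero,
      Real.zero_rpow h2H, abs_sub_comm (r : ℝ) s]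
    ring
  have hspan : stepIntegral hX.toIsCenteredGaussian (truncate r f) ∈
        Submodule.span ℝ (range G) ∧
      stepIntegral hX.toIsCenteredGaussian f -
        stepIntegral hX.toIsCenteredGaussian (truncate r f) ∈ Submodule.span ℝ (range F) := by
    induction f using stepFn_induction with
    | hind t =>
      rw [truncate_ind, stepIntegral_ind, stepIntegral_ind]
      have h0T : (0 : ℝ) ≤ T := r.2.1.trans r.2.2
      have hz : b ⟨0, le_rfl, h0T⟩ = 0 := by
        rw [← norm_eq_zero, ← sq_eq_zero_iff, ← real_inner_self_eq_norm_sq, hb]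
        simp [Real.zero_rpow h2H]
      constructor
      -- Since `b 0 = 0`, the value at `t ∧ r` is a difference of two past increments.
      · have : b (min t r) = G ⟨min t r, min_le_right _ _⟩ - G ⟨⟨0, le_rfl, h0T⟩, r.2.1⟩ := by
          simp only [G, hz]
          abel
        change b (min t r) ∈ _
        rw [this]
        exact Submodule.sub_mem _ (Submodule.subset_span (mem_range_self _))
          (Submodule.subset_span (mem_range_self _))
      · rcases le_total r t with h | h
        · rw [min_eq_right h]
          exact Submodule.subset_span ⟨⟨t, h⟩, rfl⟩
        · rw [min_eq_left h, sub_self]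
          exact zero_mem _
    | hzero => simp
    | hadd f g hf hg =>
      simp only [map_add, add_sub_add_comm]
      exact ⟨add_mem hf.1 hg.1, add_mem hf.2 hg.2⟩
    | hsmul a f hf =>
      simp only [map_smul, ← smul_sub]
      exact ⟨Submodule.smul_mem _ _ hf.1, Submodule.smul_mem _ _ hf.2⟩
  have h := hK (Lp ℝ 2 P) _ _ F G (fun t => (t.1 : ℝ) - r) (fun t => (r : ℝ) - t.1)
    (fun t => sub_nonneg.2 t.2) (fun t => sub_nonneg.2 t.2)
    (fun t s => by
      simp only [F, hb2, fracCov, sub_sub_sub_cancel_right]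
      rw [abs_of_nonneg (sub_nonneg.2 (Subtype.coe_le_coe.2 t.2)),
        abs_of_nonneg (sub_nonneg.2 (Subtype.coe_le_coe.2 s.2))])
    (fun t s => by
      simp only [G, hb2, fracCov, sub_sub_sub_cancel_left]
      rw [abs_sub_comm (t.1 : ℝ) r, abs_sub_comm (s.1 : ℝ) r, abs_sub_comm (s.1 : ℝ),
        abs_of_nonneg (sub_nonneg.2 (Subtype.coe_le_coe.2 t.2)),
        abs_of_nonneg (sub_nonneg.2 (Subtype.coe_le_coe.2 s.2))])
    (fun t s => by
      have h1 := sub_nonneg.2 (Subtype.coe_le_coe.2 t.2)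
      have h2 := sub_nonneg.2 (Subtype.coe_le_coe.2 s.2)
      simp only [F, G, hb2, fracCrossCov, sub_add_sub_cancel]
      rw [abs_sub_comm (s.1 : ℝ) r, abs_of_nonneg h1, abs_of_nonneg h2,
        abs_of_nonneg (by linarith)])
    _ hspan.2 _ hspan.1
  rwa [sub_add_cancel] at h

end Criterion

section Independent

variable {Ω : Type*} [MeasurableSpace Ω] {P : Measure Ω} {T : ℝ} {X₁ X₂ : Icc (0 : ℝ) T → Ω → ℝ}

/-! ### Sums of independent processes -/

theorem IsCenteredGaussian.add_mul_of_indepFun (h₁ : IsCenteredGaussian X₁ P)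
    (h₂ : IsCenteredGaussian X₂ P) (γ : ℝ)
    (hind : IndepFun (fun ω t => X₁ t ω) (fun ω t => X₂ t ω) P) :
    IsCenteredGaussian (fun t ω => X₁ t ω + γ * X₂ t ω) P where
  gaussian := ⟨fun I => by
    have hi : IndepFun (fun ω => I.restrict (X₁ · ω)) (fun ω => I.restrict (X₂ · ω)) P :=
      hind.comp (φ := I.restrict) (ψ := I.restrict) (by fun_prop) (by fun_prop)
    have hg := hi.hasGaussianLaw (h₁.gaussian.hasGaussianLaw I) (h₂.gaussian.hasGaussianLaw I)
    exact hg.map_fun (ContinuousLinearMap.fst ℝ (I → ℝ) (I → ℝ) +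
      γ • ContinuousLinearMap.snd ℝ (I → ℝ) (I → ℝ))⟩
  centered t := by
    have i₁ := (h₁.gaussian.hasGaussianLaw_eval t).integrable
    have i₂ := (h₂.gaussian.hasGaussianLaw_eval t).integrable
    rw [integral_add i₁ (i₂.const_mul γ), integral_const_mul, h₁.centered, h₂.centered]
    simp
  start t ht := by
    filter_upwards [h₁.start t ht, h₂.start t ht] with ω e₁ e₂
    simp [e₁, e₂]

theorem inner_stepIntegral_eq_zero (h₁ : IsCenteredGaussian X₁ P) (h₂ : IsCenteredGaussian X₂ P)
    (hind : IndepFun (fun ω t => X₁ t ω) (fun ω t => X₂ t ω) P) (f g : StepFn T) :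
    inner ℝ (stepIntegral h₁ f) (stepIntegral h₂ g) = 0 := by
  induction f using stepFn_induction with
  | hind t =>
    induction g using stepFn_induction with
    | hind s =>
      rw [stepIntegral_ind, stepIntegral_ind, L2.inner_def]
      have hi : IndepFun (X₁ t) (X₂ s) P :=
        hind.comp (measurable_pi_apply t) (measurable_pi_apply s)
      have : ∫ ω, X₁ t ω * X₂ s ω ∂P = 0 := by
        rw [hi.integral_fun_mul_eq_mul_integral (h₁.memLp t).1 (h₂.memLp s).1, h₁.centered,
          zero_mul]
      rw [← this]
      apply integral_congr_ae
      filter_upwards [(h₁.memLp t).coeFn_toLp, (h₂.memLp s).coeFn_toLp] with ω e1 e2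
      rw [e1, e2]
      simp [mul_comm]
    | hzero => simp
    | hadd f g hf hg => rw [map_add, inner_add_right, hf, hg, add_zero]
    | hsmul a f hf => rw [map_smul, real_inner_smul_right, hf, mul_zero]
  | hzero => simp
  | hadd f g hf hg => rw [map_add, inner_add_left, hf, hg, add_zero]
  | hsmul a f hf => rw [map_smul, real_inner_smul_left, hf, mul_zero]

/-- Orthogonality of the two Wiener integrals gives `‖I(f)‖² = ‖I₁(f)‖² + γ² ‖I₂(f)‖²`, so
truncation for the sum is bounded by the larger of the two operator norms. -/
theorem HasIndefiniteWienerIntegral.add_mul_of_indepFun {γ : ℝ}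
    (hind : IndepFun (fun ω t => X₁ t ω) (fun ω t => X₂ t ω) P)
    (h₁ : HasIndefiniteWienerIntegral X₁ P) (h₂ : HasIndefiniteWienerIntegral X₂ P) :
    HasIndefiniteWienerIntegral (fun t ω => X₁ t ω + γ * X₂ t ω) P := by
  obtain ⟨g₁, h₁⟩ := h₁
  obtain ⟨g₂, h₂⟩ := h₂
  have hX := g₁.add_mul_of_indepFun g₂ γ hind
  refine ⟨hX, fun r => ?_⟩
  obtain ⟨A₁, hA₁⟩ := h₁ r
  obtain ⟨A₂, hA₂⟩ := h₂ r
  have hsum : ∀ f : StepFn T,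
      stepIntegral hX f = stepIntegral g₁ f + γ • stepIntegral g₂ f := fun f => by
    refine stepFn_hom_ext (M := stepIntegral g₁ + γ • stepIntegral g₂) (fun t => ?_) f
    rw [LinearMap.add_apply, LinearMap.smul_apply, stepIntegral_ind, stepIntegral_ind,
      stepIntegral_ind, ← MemLp.toLp_const_smul, ← MemLp.toLp_add]
    rfl
  have hnorm : ∀ f : StepFn T, ‖stepIntegral hX f‖ ^ 2 =
      ‖stepIntegral g₁ f‖ ^ 2 + γ ^ 2 * ‖stepIntegral g₂ f‖ ^ 2 := fun f => by
    rw [hsum, norm_add_sq_real, real_inner_smul_right, inner_stepIntegral_eq_zero g₁ g₂ hind,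
      norm_smul, mul_pow, Real.norm_eq_abs, sq_abs]
    ring
  refine exists_indefinite_operator hX (C := max ‖A₁‖ ‖A₂‖) fun f => ?_
  set C := max ‖A₁‖ ‖A₂‖
  have hC : 0 ≤ C := (norm_nonneg A₁).trans (le_max_left _ _)
  have b₁ : ‖stepIntegral g₁ (truncate r f)‖ ≤ C * ‖stepIntegral g₁ f‖ :=
    (norm_stepIntegral_truncate_le g₁ hA₁ f).trans
      (mul_le_mul_of_nonneg_right (le_max_left _ _) (norm_nonneg _))
  have b₂ : ‖stepIntegral g₂ (truncate r f)‖ ≤ C * ‖stepIntegral g₂ f‖ :=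
    (norm_stepIntegral_truncate_le g₂ hA₂ f).trans
      (mul_le_mul_of_nonneg_right (le_max_right _ _) (norm_nonneg _))
  refine le_of_sq_le_sq ?_ (mul_nonneg hC (norm_nonneg _))
  calc _ = ‖stepIntegral g₁ (truncate r f)‖ ^ 2 +
        γ ^ 2 * ‖stepIntegral g₂ (truncate r f)‖ ^ 2 := hnorm _
    _ ≤ (C * ‖stepIntegral g₁ f‖) ^ 2 + γ ^ 2 * (C * ‖stepIntegral g₂ f‖) ^ 2 := by gcongr
    _ = (C * ‖stepIntegral hX f‖) ^ 2 := by rw [mul_pow C ‖stepIntegral hX f‖, hnorm]; ring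

end Independent

/-! ### Gaussian laws and limits in `L²` -/

section Limit

variable {Ω : Type*} [MeasurableSpace Ω] {P : Measure Ω}

/-- On a probability space the `L¹` norm is at most the `L²` norm. Taking for `φ` the inclusion of
`ℝ` and `x ↦ exp(i x)` shows that means and characteristic functions pass to `L²` limits. -/
theorem lipschitzWith_integral_comp_Lp [IsProbabilityMeasure P] {φ : ℝ → ℂ}
    (hφ : LipschitzWith 1 φ) : LipschitzWith 1 fun Z : Lp ℝ 2 P => ∫ ω, φ (Z ω) ∂P := by
  have hint : ∀ Z : Lp ℝ 2 P, Integrable (fun ω => φ (Z ω)) P := fun Z => by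
    have hZ : Integrable (fun ω => ‖φ 0‖ + ‖Z ω‖) P :=
      (integrable_const _).add ((Lp.memLp Z).integrable one_le_two).norm
    refine hZ.mono' (hφ.continuous.comp_aestronglyMeasurable (Lp.aestronglyMeasurable Z))
      (Eventually.of_forall fun ω => ?_)
    have h1 := hφ.dist_le_mul (Z ω) 0
    rw [dist_eq_norm, dist_zero_right] at h1
    calc ‖φ (Z ω)‖ = ‖φ 0 + (φ (Z ω) - φ 0)‖ := by rw [add_sub_cancel]
      _ ≤ _ := (norm_add_le _ _).trans (by gcongr; simpa using h1)
  refine LipschitzWith.of_dist_le_mul fun Z Y => ?_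
  rw [dist_eq_norm, dist_eq_norm, ← integral_sub (hint _) (hint _), NNReal.coe_one, one_mul]
  have hm : MemLp (fun ω => Z ω - Y ω) 2 P := (Lp.memLp Z).sub (Lp.memLp Y)
  calc ‖∫ ω, φ (Z ω) - φ (Y ω) ∂P‖ ≤ ∫ ω, ‖Z ω - Y ω‖ ∂P := by
        refine norm_integral_le_of_norm_le (hm.integrable one_le_two).norm
          (Eventually.of_forall fun ω => ?_)
        have := hφ.dist_le_mul (Z ω) (Y ω)
        rw [dist_eq_norm, dist_eq_norm] at this
        simpa using this
    _ = (eLpNorm (fun ω => Z ω - Y ω) 1 P).toReal := by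
        rw [eLpNorm_one_eq_lintegral_enorm, integral_norm_eq_lintegral_enorm hm.1]
    _ ≤ (eLpNorm (fun ω => Z ω - Y ω) 2 P).toReal :=
        ENNReal.toReal_mono hm.2.ne (eLpNorm_le_eLpNorm_of_exponent_le one_le_two hm.1)
    _ = ‖Z - Y‖ := by
        rw [Lp.norm_def]
        congr 1
        exact eLpNorm_congr_ae (Lp.coeFn_sub _ _).symm

theorem lipschitzWith_exp_mul_I : LipschitzWith 1 fun x : ℝ => Complex.exp (x * Complex.I) := by
  refine LipschitzWith.of_dist_le_mul fun x y => ?_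
  rw [dist_eq_norm, dist_eq_norm, NNReal.coe_one, one_mul]
  have e : Complex.exp (x * Complex.I) - Complex.exp (y * Complex.I) =
      Complex.exp (y * Complex.I) * (Complex.exp (Complex.I * (x - y : ℝ)) - 1) := by
    rw [mul_sub, ← Complex.exp_add, mul_one]
    congr 2
    push_cast
    ring
  rw [e, norm_mul, Complex.norm_exp_ofReal_mul_I, one_mul]
  exact Real.norm_exp_I_mul_ofReal_sub_one_le

theorem integral_sq_Lp (Z : Lp ℝ 2 P) : ∫ ω, Z ω ^ 2 ∂P = ‖Z‖ ^ 2 := by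
  rw [← real_inner_self_eq_norm_sq, L2.inner_def]
  exact integral_congr_ae (Eventually.of_forall fun ω => by simp [sq])

variable {T : ℝ} {X : Icc (0 : ℝ) T → Ω → ℝ}

theorem hasGaussianLaw_stepIntegral (hX : IsCenteredGaussian X P) (f : StepFn T) :
    HasGaussianLaw (stepIntegral hX f) P := by
  let e : Ioc (0 : ℝ) T → Icc (0 : ℝ) T := Set.inclusion Ioc_subset_Icc_self
  let c := (linearIndependent_indFamily T).repr f
  have hsum : ∀ s : Finset (Ioc (0 : ℝ) T),
      (fun ω => ∑ t ∈ s, (fun t ω => c t • (X ∘ e) t ω) t ω) =ᵐ[P]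
        ((∑ t ∈ s, c t • (hX.memLp (e t)).toLp (X (e t)) : Lp ℝ 2 P) : Ω → ℝ) := by
    intro s
    induction s using Finset.induction_on with
    | empty =>
      simp only [Finset.sum_empty]
      exact (Lp.coeFn_zero ℝ 2 P).symm
    | insert a s ha ih =>
      rw [Finset.sum_insert ha]
      filter_upwards [ih, Lp.coeFn_add (c a • (hX.memLp (e a)).toLp (X (e a)))
        (∑ t ∈ s, c t • (hX.memLp (e t)).toLp (X (e t))),
        Lp.coeFn_smul (c a) ((hX.memLp (e a)).toLp (X (e a))), (hX.memLp (e a)).coeFn_toLp]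
        with ω h1 h2 h3 h4
      rw [Finset.sum_insert ha, h1, h2, Pi.add_apply, h3, Pi.smul_apply, h4]
      rfl
  exact ((hX.gaussian.comp_right e).smul c).hasGaussianLaw_fun_sum.congr (hsum c.support)

theorem integrands_induction (hX : IsCenteredGaussian X P) {p : Integrands hX → Prop}
    (hp : IsClosed {h | p h}) (ih : ∀ f : StepFn T, p (stepIntegrand hX f)) (h : Integrands hX) :
    p h :=
  UniformSpace.Completion.induction_on h hp ih

theorem integral_wienerIntegral [IsProbabilityMeasure P] (hX : IsCenteredGaussian X P)
    (h : Integrands hX) : ∫ ω, wienerIntegral hX h ω ∂P = 0 := by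
  have hcont : Continuous fun Z : Lp ℝ 2 P => ∫ ω, ((Z ω : ℝ) : ℂ) ∂P :=
    (lipschitzWith_integral_comp_Lp (φ := fun x => (x : ℂ))
      (LipschitzWith.of_dist_le_mul fun x y => by
        rw [dist_eq_norm, dist_eq_norm, ← Complex.ofReal_sub, Complex.norm_real]; simp)).continuous
  rw [← Complex.ofReal_eq_zero, ← integral_complex_ofReal]
  induction h using integrands_induction with
  | hp => exact isClosed_eq (hcont.comp (wienerIntegral hX).continuous) continuous_const
  | ih f =>
    rw [wienerIntegral_stepIntegrand, integral_complex_ofReal, Complex.ofReal_eq_zero]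
    induction f using stepFn_induction with
    | hind t =>
      rw [stepIntegral_ind, integral_congr_ae (hX.memLp t).coeFn_toLp, hX.centered]
    | hzero =>
      rw [map_zero, integral_congr_ae (Lp.coeFn_zero ℝ 2 P)]
      simp
    | hadd f g hf hg =>
      rw [map_add, integral_congr_ae (Lp.coeFn_add _ _)]
      simp only [Pi.add_apply]
      rw [integral_add ((Lp.memLp _).integrable one_le_two) ((Lp.memLp _).integrable one_le_two),
        hf, hg, add_zero]
    | hsmul a f hf =>
      rw [map_smul, integral_congr_ae (Lp.coeFn_smul _ _)]
      simp only [Pi.smul_apply]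
      rw [integral_smul, hf, smul_zero]

/-- Both sides are continuous in `h`. On step functions this is the characteristic function, at 1,
of a centered Gaussian variable whose variance is `‖h‖²`. -/
theorem integral_exp_wienerIntegral [IsProbabilityMeasure P] (hX : IsCenteredGaussian X P)
    (h : Integrands hX) : ∫ ω, Complex.exp (wienerIntegral hX h ω * Complex.I) ∂P =
      Complex.exp (-((‖h‖ ^ 2 : ℝ) : ℂ) / 2) := by
  induction h using integrands_induction with
  | hp =>
    exact isClosed_eq ((lipschitzWith_integral_comp_Lp lipschitzWith_exp_mul_I).continuous.comp
      (wienerIntegral hX).continuous) (by fun_prop)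
  | ih f =>
    have h0 := integral_wienerIntegral hX (stepIntegrand hX f)
    rw [wienerIntegral_stepIntegrand] at h0 ⊢
    rw [norm_stepIntegrand]
    have hg := hasGaussianLaw_stepIntegral hX f
    have hc := hg.charFunDual_map_eq (ContinuousLinearMap.id ℝ ℝ)
    rw [charFunDual_apply, integral_map hg.aemeasurable (by fun_prop)] at hc
    refine hc.trans ?_
    have hv : Var[stepIntegral hX f; P] = ‖stepIntegral hX f‖ ^ 2 := by
      rw [variance_of_integral_eq_zero hg.aemeasurable h0, integral_sq_Lp]
    change Complex.exp (((∫ ω, stepIntegral hX f ω ∂P : ℝ) : ℂ) * Complex.I -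
      ((Var[stepIntegral hX f; P] : ℝ) : ℂ) / 2) = _
    rw [h0, hv]
    congr 1
    push_cast
    ring

/-- Wiener integrals form a Gaussian process. -/
theorem isGaussianProcess_wienerIntegral [IsProbabilityMeasure P] (hX : IsCenteredGaussian X P)
    {S : Type*} {Y : S → Ω → ℝ} (h : S → Integrands hX)
    (hY : ∀ s, Y s =ᵐ[P] wienerIntegral hX (h s)) : IsGaussianProcess Y P := by
  classical
  refine ⟨fun I => ?_⟩
  have hm : AEMeasurable (fun ω => I.restrict (Y · ω)) P :=
    aemeasurable_pi_lambda _ fun i =>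
      ((Lp.aestronglyMeasurable (wienerIntegral hX (h i))).congr (hY i).symm).aemeasurable
  refine (hasGaussianLaw_iff_charFunDual_map_eq hm).2 fun L => ?_
  -- Any linear functional of finitely many Wiener integrals is itself a Wiener integral, so the
  -- one-dimensional formula suffices.
  set g : Integrands hX := ∑ i : I, L (Pi.single i 1) • h i with hg
  have hL : (L ∘ fun ω => I.restrict (Y · ω)) =ᵐ[P] wienerIntegral hX g := by
    have hs : ∀ᵐ ω ∂P, wienerIntegral hX g ω =
        ∑ i : I, L (Pi.single i 1) * wienerIntegral hX (h i) ω := by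
      rw [hg, map_sum]
      simp only [map_smul]
      generalize (Finset.univ : Finset I) = J
      induction J using Finset.induction_on with
      | empty =>
        simp only [Finset.sum_empty]
        exact Lp.coeFn_zero ℝ 2 P
      | insert a s ha ih =>
        rw [Finset.sum_insert ha]
        filter_upwards [ih, Lp.coeFn_add (L (Pi.single a 1) • wienerIntegral hX (h a))
          (∑ t ∈ s, L (Pi.single t 1) • wienerIntegral hX (h t)),
          Lp.coeFn_smul (L (Pi.single a 1)) (wienerIntegral hX (h a))] with ω h1 h2 h3
        rw [Finset.sum_insert ha, h2, Pi.add_apply, h1, h3]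
        rfl
    have hall : ∀ᵐ ω ∂P, ∀ i : I, Y i ω = wienerIntegral hX (h i) ω :=
      ae_all_iff.2 fun i => hY i
    filter_upwards [hs, hall] with ω h1 h2
    rw [h1, Function.comp_apply, pi_eq_sum_univ' (I.restrict (Y · ω)), map_sum]
    refine Finset.sum_congr rfl fun i _ => ?_
    rw [map_smul, smul_eq_mul, mul_comm, Finset.restrict, h2]
  have hLm : AEMeasurable (L ∘ fun ω => I.restrict (Y · ω)) P := by fun_prop
  rw [charFunDual_apply, integral_map hm (by fun_prop)]
  have h0 : P[L ∘ fun ω => I.restrict (Y · ω)] = 0 := by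
    rw [integral_congr_ae hL, integral_wienerIntegral]
  have hv : Var[L ∘ fun ω => I.restrict (Y · ω); P] = ‖g‖ ^ 2 := by
    rw [variance_of_integral_eq_zero hLm h0, ← norm_wienerIntegral hX g, ← integral_sq_Lp]
    exact integral_congr_ae (hL.fun_comp (· ^ 2))
  rw [h0, hv]
  refine (integral_congr_ae (hL.fun_comp fun x : ℝ => Complex.exp (x * Complex.I))).trans ?_
  refine (integral_exp_wienerIntegral hX g).trans ?_
  congr 1
  push_cast
  ring

end Limit

/-! ### The kernel `|s - u| ^ (2 * H - 2)` -/

section Kernel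

/-- The kernel whose convolution square is a multiple of `|s - u| ^ (1 - 2 * b)`. -/
def halfKernel (b s y : ℝ) : ℝ≥0∞ := ENNReal.ofReal ((Iio s).indicator (fun y => (s - y) ^ (-b)) y)

@[fun_prop]
theorem measurable_halfKernel (b : ℝ) {α : Type*} [MeasurableSpace α] {f g : α → ℝ}
    (hf : Measurable f) (hg : Measurable g) : Measurable fun z => halfKernel b (f z) (g z) := by
  have h : (fun z => halfKernel b (f z) (g z)) = fun z => ENNReal.ofReal
      ({z | g z < f z}.indicator (fun z => (f z - g z) ^ (-b)) z) := by
    funext z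
    simp only [halfKernel, indicator, mem_Iio, mem_ofPred_eq]
  rw [h]
  exact ((by fun_prop : Measurable fun z => (f z - g z) ^ (-b)).indicator
    (measurableSet_lt hg hf)).ennreal_ofReal

theorem integrableOn_rpow_mul_add_one_rpow {b : ℝ} (hb : 1 / 2 < b) (hb1 : b < 1) :
    IntegrableOn (fun z : ℝ => z ^ (-b) * (z + 1) ^ (-b)) (Ioi 0) := by
  refine integrableOn_Ioi_of_rpow_bounds (A := 1) (B := 1) (p := -b) (q := -b + -b)
    (by fun_prop) (by linarith) (by linarith) (fun x hx => ?_) (fun x hx => ?_)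
  · have h0 := Real.rpow_nonneg hx.1.le (-b)
    have h1 := Real.rpow_nonneg (by linarith [hx.1] : (0 : ℝ) ≤ x + 1) (-b)
    rw [abs_of_nonneg (mul_nonneg h0 h1), mul_comm]
    exact mul_le_mul_of_nonneg_right
      (Real.rpow_le_one_of_one_le_of_nonpos (by linarith [hx.1]) (by linarith)) h0
  · have hx0 : (0 : ℝ) < x := one_pos.trans hx
    have h0 := Real.rpow_nonneg hx0.le (-b)
    have h1 := Real.rpow_nonneg (by linarith : (0 : ℝ) ≤ x + 1) (-b)
    rw [abs_of_nonneg (mul_nonneg h0 h1), one_mul, Real.rpow_add hx0]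
    exact mul_le_mul_of_nonneg_left
      (Real.rpow_le_rpow_of_nonpos hx0 (by linarith) (by linarith)) h0

/-- The constant in `lintegral_halfKernel_mul`. -/
def halfKernelConst (b : ℝ) : ℝ := ∫ z in Ioi (0 : ℝ), z ^ (-b) * (z + 1) ^ (-b)

theorem halfKernelConst_pos {b : ℝ} (hb : 1 / 2 < b) (hb1 : b < 1) : 0 < halfKernelConst b := by
  have hpos : ∀ x ∈ Ioi (0 : ℝ), 0 < x ^ (-b) * (x + 1) ^ (-b) := fun x hx =>
    mul_pos (Real.rpow_pos_of_pos hx _)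
      (Real.rpow_pos_of_pos (by linarith [mem_Ioi.1 hx]) _)
  exact setIntegral_Ioi_pos (integrableOn_rpow_mul_add_one_rpow hb hb1)
    (fun x hx => (hpos x hx).le) fun x hx => hpos x hx.1

/-- Substitute `y = u - z` and scale `z` by `d = s - u`. The condition `b < 1` gives integrability
at the singularity, `1 / 2 < b` at infinity. -/
theorem lintegral_halfKernel_mul_of_lt {b : ℝ} (hb : 1 / 2 < b) (hb1 : b < 1) {s u : ℝ}
    (hus : u < s) : ∫⁻ y, halfKernel b s y * halfKernel b u y =
      ENNReal.ofReal (halfKernelConst b * |s - u| ^ (1 - 2 * b)) := by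
  set d := s - u with hd
  have hd0 : 0 < d := sub_pos.2 hus
  have h1 : ∀ y, halfKernel b s (u - y) * halfKernel b u (u - y) =
      (Ioi (0 : ℝ)).indicator (fun z => ENNReal.ofReal (z ^ (-b) * (z + d) ^ (-b))) y := by
    intro y
    by_cases hy : 0 < y
    · rw [indicator_of_mem (mem_Ioi.2 hy), halfKernel, halfKernel,
        indicator_of_mem (mem_Iio.2 (by linarith)), indicator_of_mem (mem_Iio.2 (by linarith)),
        ← ENNReal.ofReal_mul (Real.rpow_nonneg (by linarith) _), mul_comm, sub_sub_cancel,
        show s - (u - y) = y + d by rw [hd]; ring]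
    · rw [indicator_of_notMem (show y ∉ Ioi (0 : ℝ) from hy), halfKernel, halfKernel,
        indicator_of_notMem (a := u - y) (s := Iio u) (fun h => hy (by linarith [mem_Iio.1 h]))]
      simp
  rw [← lintegral_sub_left_eq_self _ u]
  simp only [h1]
  rw [lintegral_indicator measurableSet_Ioi]
  have hcomp : ∀ x ∈ Ioi (0 : ℝ), (d * x) ^ (-b) * (d * x + d) ^ (-b) =
      d ^ (-(2 * b)) * (x ^ (-b) * (x + 1) ^ (-b)) := fun x hx => by
    have hx0 : 0 < x := hx
    rw [show d * x + d = d * (x + 1) by ring, Real.mul_rpow hd0.le hx0.le,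
      Real.mul_rpow hd0.le (by linarith), show -(2 * b) = -b + -b by ring, Real.rpow_add hd0]
    ring
  have hi : IntegrableOn (fun x : ℝ => x ^ (-b) * (x + d) ^ (-b)) (Ioi 0) := by
    have h := integrableOn_Ioi_comp_mul_left_iff (fun x : ℝ => x ^ (-b) * (x + d) ^ (-b)) 0 hd0
    rw [mul_zero] at h
    refine h.1 (IntegrableOn.congr_fun ?_ (fun x hx => (hcomp x hx).symm) measurableSet_Ioi)
    exact (integrableOn_rpow_mul_add_one_rpow hb hb1).const_mul _
  rw [← ofReal_integral_eq_lintegral_ofReal hi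
    (ae_restrict_of_forall_mem measurableSet_Ioi fun x hx =>
      mul_nonneg (Real.rpow_nonneg (mem_Ioi.1 hx).le _)
        (Real.rpow_nonneg (by linarith [mem_Ioi.1 hx]) _))]
  congr 1
  have h := integral_comp_mul_left_Ioi (fun x : ℝ => x ^ (-b) * (x + d) ^ (-b)) 0 hd0
  rw [mul_zero, smul_eq_mul, eq_inv_mul_iff_mul_eq₀ hd0.ne',
    setIntegral_congr_fun measurableSet_Ioi hcomp, integral_const_mul] at h
  rw [← h, abs_of_pos hd0, show 1 - 2 * b = 1 + -(2 * b) by ring, Real.rpow_add hd0, Real.rpow_one,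
    halfKernelConst]
  ring

theorem lintegral_halfKernel_mul {b : ℝ} (hb : 1 / 2 < b) (hb1 : b < 1) {s u : ℝ} (h : s ≠ u) :
    ∫⁻ y, halfKernel b s y * halfKernel b u y =
      ENNReal.ofReal (halfKernelConst b) * ENNReal.ofReal (|s - u| ^ (1 - 2 * b)) := by
  rw [← ENNReal.ofReal_mul (halfKernelConst_pos hb hb1).le]
  rcases h.lt_or_gt with h | h
  · simp only [mul_comm (halfKernel b s _)]
    rw [lintegral_halfKernel_mul_of_lt hb hb1 h, abs_sub_comm]
  · exact lintegral_halfKernel_mul_of_lt hb hb1 h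

/-- Insert the convolution formula and apply Tonelli. The formula fails on the diagonal, which is
negligible because `μ` has no atoms. The double integral becomes a squared `L²` norm. -/
theorem lintegral_kernel_eq_lintegral_sq {b : ℝ} (hb : 1 / 2 < b) (hb1 : b < 1) {μ : Measure ℝ}
    [SFinite μ] [NullSingletonClass μ] {F : ℝ → ℝ≥0∞} (hF : Measurable F) :
    ENNReal.ofReal (halfKernelConst b) *
        ∫⁻ s, ∫⁻ u, F s * F u * ENNReal.ofReal (|s - u| ^ (1 - 2 * b)) ∂μ ∂μ =
      ∫⁻ y, (∫⁻ s, F s * halfKernel b s y ∂μ) ^ 2 := by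
  have h1 : ∀ s, ∫⁻ u, F s * F u * (ENNReal.ofReal (halfKernelConst b) *
      ENNReal.ofReal (|s - u| ^ (1 - 2 * b))) ∂μ =
      ∫⁻ u, (∫⁻ y, F s * F u * (halfKernel b s y * halfKernel b u y)) ∂μ := fun s => by
    have hne : ∀ᵐ u ∂μ, u ≠ s := by simp [ae_iff]
    refine lintegral_congr_ae (hne.mono fun u hu => ?_)
    simp only
    rw [← lintegral_halfKernel_mul hb hb1 hu.symm, lintegral_const_mul _ (by fun_prop)]
  calc _ = ∫⁻ s, ∫⁻ u, F s * F u * (ENNReal.ofReal (halfKernelConst b) *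
        ENNReal.ofReal (|s - u| ^ (1 - 2 * b))) ∂μ ∂μ := by
        rw [← lintegral_const_mul _ (Measurable.lintegral_prod_right (by fun_prop))]
        refine lintegral_congr fun s => ?_
        rw [← lintegral_const_mul _ (by fun_prop)]
        exact lintegral_congr fun u => by ring
    _ = ∫⁻ s, ∫⁻ u, (∫⁻ y, F s * F u * (halfKernel b s y * halfKernel b u y)) ∂μ ∂μ :=
        lintegral_congr h1
    _ = ∫⁻ s, (∫⁻ y, (∫⁻ u, F s * F u * (halfKernel b s y * halfKernel b u y) ∂μ)) ∂μ := by
        refine lintegral_congr fun s => ?_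
        exact lintegral_lintegral_swap
          (f := fun u y => F s * F u * (halfKernel b s y * halfKernel b u y)) (by fun_prop)
    _ = ∫⁻ s, (∫⁻ y, F s * halfKernel b s y * (∫⁻ u, F u * halfKernel b u y ∂μ)) ∂μ := by
        refine lintegral_congr fun s => lintegral_congr fun y => ?_
        rw [← lintegral_const_mul _ (by fun_prop)]
        exact lintegral_congr fun u => by ring
    _ = ∫⁻ y, ∫⁻ s, F s * halfKernel b s y * (∫⁻ u, F u * halfKernel b u y ∂μ) ∂μ := by
        have hm : Measurable fun y => ∫⁻ u, F u * halfKernel b u y ∂μ :=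
          Measurable.lintegral_prod_left' (f := fun z : ℝ × ℝ => F z.1 * halfKernel b z.1 z.2)
            (by fun_prop)
        exact lintegral_lintegral_swap
          (f := fun s y => F s * halfKernel b s y * (∫⁻ u, F u * halfKernel b u y ∂μ))
          (by fun_prop)
    _ = _ := by
        refine lintegral_congr fun y => ?_
        rw [lintegral_mul_const _ (by fun_prop), sq]

theorem ennreal_add_sq_le (a b : ℝ≥0∞) : (a + b) ^ 2 ≤ 2 * (a ^ 2 + b ^ 2) := by
  have h := ENNReal.rpow_add_le_mul_rpow_add_rpow a b one_le_two
  norm_num at h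
  exact h

theorem fracNormSq_congr {H T : ℝ} {f g : ℝ → ℝ} (h : f =ᵐ[volume.restrict (Icc 0 T)] g) :
    fracNormSq H T f = fracNormSq H T g := by
  refine lintegral_congr_ae (h.mono fun s hs => ?_)
  refine lintegral_congr_ae (h.mono fun u hu => ?_)
  simp only [hs, hu]

theorem fracNormSq_mono {H T : ℝ} {f g : ℝ → ℝ} (h : ∀ s, ‖f s‖ₑ ≤ ‖g s‖ₑ) :
    fracNormSq H T f ≤ fracNormSq H T g := by
  refine lintegral_mono fun s => lintegral_mono fun u => ?_
  exact mul_le_mul_left (mul_le_mul' (h s) (h u)) _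

theorem fracNormSq_neg {H T : ℝ} (f : ℝ → ℝ) : fracNormSq H T (-f) = fracNormSq H T f := by
  simp [fracNormSq]

theorem halfKernelConst_mul_fracNormSq {H T : ℝ} (hH : H ∈ Ioo (1 / 2 : ℝ) 1) {f : ℝ → ℝ}
    (hf : Measurable f) :
    ENNReal.ofReal (halfKernelConst (3 / 2 - H)) * fracNormSq H T f =
      ∫⁻ y, (∫⁻ s in Icc 0 T, ‖f s‖ₑ * halfKernel (3 / 2 - H) s y) ^ 2 := by
  rw [← lintegral_kernel_eq_lintegral_sq (by linarith [hH.2]) (by linarith [hH.1]) hf.enorm,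
    fracNormSq, show 1 - 2 * (3 / 2 - H) = 2 * H - 2 by ring]

/-- After writing `fracNormSq` as an integral of squares, with `b = 3/2 - H` since `1 - 2b = 2H -
2`, the pointwise inequality `(a + b)² ≤ 2(a² + b²)` suffices. -/
theorem fracNormSq_add_le {H T : ℝ} (hH : H ∈ Ioo (1 / 2 : ℝ) 1) {f g : ℝ → ℝ}
    (hf : AEMeasurable f (volume.restrict (Icc 0 T)))
    (hg : AEMeasurable g (volume.restrict (Icc 0 T))) :
    fracNormSq H T (f + g) ≤ 2 * (fracNormSq H T f + fracNormSq H T g) := by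
  rw [fracNormSq_congr (hf.ae_eq_mk.add hg.ae_eq_mk), fracNormSq_congr hf.ae_eq_mk,
    fracNormSq_congr hg.ae_eq_mk]
  have mf := hf.measurable_mk
  have mg := hg.measurable_mk
  generalize hf.mk f = f' at *
  generalize hg.mk g = g' at *
  have hc := halfKernelConst_pos (b := 3 / 2 - H) (by linarith [hH.2]) (by linarith [hH.1])
  have hk : ∀ f : ℝ → ℝ, Measurable f →
      Measurable fun y => ∫⁻ s in Icc 0 T, ‖f s‖ₑ * halfKernel (3 / 2 - H) s y := fun f hf =>
    Measurable.lintegral_prod_left' (f := fun z : ℝ × ℝ => ‖f z.1‖ₑ * halfKernel (3 / 2 - H) z.1 z.2)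
      (by fun_prop)
  rw [← ENNReal.mul_le_mul_iff_right (a := ENNReal.ofReal (halfKernelConst (3 / 2 - H)))
    (by simpa using hc) ENNReal.ofReal_ne_top, mul_left_comm, mul_add,
    halfKernelConst_mul_fracNormSq hH (mf.add mg), halfKernelConst_mul_fracNormSq hH mf,
    halfKernelConst_mul_fracNormSq hH mg, ← lintegral_add_left ((hk f' mf).pow_const 2),
    ← lintegral_const_mul _ (by have := hk f' mf; have := hk g' mg; fun_prop)]
  refine lintegral_mono fun y => le_trans ?_ (ennreal_add_sq_le _ _)
  rw [← lintegral_add_left (by fun_prop)]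
  refine pow_le_pow_left' (lintegral_mono fun s => ?_) 2
  rw [← add_mul]
  exact mul_le_mul_left (enorm_add_le _ _) _

end Kernel

/-! ### Integrals of `|x - y| ^ a` and comparison of `fracNormSq` with the `L²` norm -/

theorem integral_abs_sub_rpow {a : ℝ} (ha : -1 < a) {x s : ℝ} (hx : 0 ≤ x) (hxs : x ≤ s) :
    IntegrableOn (fun y => |x - y| ^ a) (Ioc 0 s) ∧
    ∫ y in Ioc 0 s, |x - y| ^ a = (x ^ (a + 1) + (s - x) ^ (a + 1)) / (a + 1) := by
  have ha1 : a + 1 ≠ 0 := by linarith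
  have e₁ : EqOn (fun y => (x - y) ^ a) (fun y => |x - y| ^ a) (uIcc 0 x) := fun y hy => by
    rw [uIcc_of_le hx] at hy
    simp only [abs_of_nonneg (sub_nonneg.2 hy.2)]
  have e₂ : EqOn (fun y => (y - x) ^ a) (fun y => |x - y| ^ a) (uIcc x s) := fun y hy => by
    rw [uIcc_of_le hxs] at hy
    simp only [abs_sub_comm x y, abs_of_nonneg (sub_nonneg.2 hy.1)]
  have i₁ : IntervalIntegrable (fun y => |x - y| ^ a) volume 0 x := by
    have h := (intervalIntegral.intervalIntegrable_rpow' ha (a := x) (b := 0)).comp_sub_left x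
    rw [sub_self, sub_zero] at h
    exact h.congr (e₁.mono uIoc_subset_uIcc)
  have i₂ : IntervalIntegrable (fun y => |x - y| ^ a) volume x s := by
    have h := (intervalIntegral.intervalIntegrable_rpow' ha (a := 0) (b := s - x)).comp_sub_right x
    rw [zero_add, sub_add_cancel] at h
    exact h.congr (e₂.mono uIoc_subset_uIcc)
  refine ⟨(intervalIntegrable_iff_integrableOn_Ioc_of_le (hx.trans hxs)).1 (i₁.trans i₂), ?_⟩
  rw [← intervalIntegral.integral_of_le (hx.trans hxs),
    ← intervalIntegral.integral_add_adjacent_intervals i₁ i₂,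
    ← intervalIntegral.integral_congr e₁, ← intervalIntegral.integral_congr e₂,
    intervalIntegral.integral_comp_sub_left (fun y => y ^ a),
    intervalIntegral.integral_comp_sub_right (fun y => y ^ a),
    integral_rpow (Or.inl ha), integral_rpow (Or.inl ha), sub_self, sub_zero, Real.zero_rpow ha1,
    sub_zero, sub_zero, add_div]

theorem lintegral_abs_sub_rpow_le {a T : ℝ} (ha : -1 < a) {s : ℝ} (hs : s ∈ Icc 0 T) :
    ∫⁻ u in Icc 0 T, ENNReal.ofReal (|s - u| ^ a) ≤
      ENNReal.ofReal (2 * T ^ (a + 1) / (a + 1)) := by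
  obtain ⟨hi, h⟩ := integral_abs_sub_rpow ha hs.1 hs.2
  rw [← restrict_Ioc_eq_restrict_Icc, ← ofReal_integral_eq_lintegral_ofReal hi
    (Eventually.of_forall fun u => Real.rpow_nonneg (abs_nonneg _) _), h]
  have h1 : 0 < a + 1 := by linarith
  have b₁ := Real.rpow_le_rpow hs.1 hs.2 h1.le
  have b₂ := Real.rpow_le_rpow (sub_nonneg.2 hs.2) (by linarith [hs.1] : T - s ≤ T) h1.le
  refine ENNReal.ofReal_le_ofReal (div_le_div_of_nonneg_right (by linarith) h1.le)

theorem integrable_abs_sub_rpow {a T : ℝ} (ha : -1 < a) :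
    Integrable (fun z : ℝ × ℝ => |z.1 - z.2| ^ a)
      ((volume.restrict (Icc 0 T)).prod (volume.restrict (Icc 0 T))) := by
  refine ⟨Measurable.aestronglyMeasurable (by fun_prop), ?_⟩
  rw [hasFiniteIntegral_iff_ofReal (Eventually.of_forall fun z => Real.rpow_nonneg (abs_nonneg _) _),
    lintegral_prod _ (by fun_prop)]
  refine (setLIntegral_mono' measurableSet_Icc fun s hs => lintegral_abs_sub_rpow_le ha hs).trans_lt ?_
  rw [lintegral_const]
  exact ENNReal.mul_lt_top ENNReal.ofReal_lt_top (by simp)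

/-- Use `ab ≤ a² + b²` and the bound, uniform in `s`, for the integral of the kernel over `[0, T]`.
Thus approximation in `L²` implies approximation in `fracNormSq`. -/
theorem fracNormSq_le_lintegral_sq {H T : ℝ} (hH : H ∈ Ioo (1 / 2 : ℝ) 1) {f : ℝ → ℝ}
    (hf : AEMeasurable f (volume.restrict (Icc 0 T))) :
    fracNormSq H T f ≤ 2 * ENNReal.ofReal (2 * T ^ (2 * H - 2 + 1) / (2 * H - 2 + 1)) *
      ∫⁻ s in Icc 0 T, ‖f s‖ₑ ^ 2 := by
  rw [fracNormSq_congr hf.ae_eq_mk,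
    lintegral_congr_ae (hf.ae_eq_mk.mono fun s hs => by
      simp only [hs] : (fun s => ‖f s‖ₑ ^ 2) =ᵐ[_] fun s => ‖hf.mk f s‖ₑ ^ 2)]
  have mf := hf.measurable_mk
  generalize hf.mk f = f at *
  set M := ENNReal.ofReal (2 * T ^ (2 * H - 2 + 1) / (2 * H - 2 + 1))
  have hab : ∀ a b : ℝ≥0∞, a * b ≤ a ^ 2 + b ^ 2 := fun a b => by
    rcases le_total a b with h | h
    · exact (mul_le_mul_left h b).trans (by rw [← sq]; exact le_add_self)
    · exact (mul_le_mul_right h a).trans (by rw [← sq]; exact le_self_add)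
  have hbd : ∫⁻ s in Icc 0 T, ∫⁻ u in Icc 0 T,
      ‖f s‖ₑ ^ 2 * ENNReal.ofReal (|s - u| ^ (2 * H - 2)) ≤ M * ∫⁻ s in Icc 0 T, ‖f s‖ₑ ^ 2 := by
    rw [← lintegral_const_mul _ (by fun_prop)]
    refine setLIntegral_mono' measurableSet_Icc fun s hs => ?_
    rw [lintegral_const_mul _ (by fun_prop), mul_comm]
    exact mul_le_mul_left (lintegral_abs_sub_rpow_le (by linarith [hH.1]) hs) _
  calc fracNormSq H T f ≤ ∫⁻ s in Icc 0 T, ∫⁻ u in Icc 0 T,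
        (‖f s‖ₑ ^ 2 * ENNReal.ofReal (|s - u| ^ (2 * H - 2)) +
          ‖f u‖ₑ ^ 2 * ENNReal.ofReal (|s - u| ^ (2 * H - 2))) := by
        refine lintegral_mono fun s => lintegral_mono fun u => ?_
        rw [← add_mul]
        exact mul_le_mul_left (hab _ _) _
    _ = (∫⁻ s in Icc 0 T, ∫⁻ u in Icc 0 T,
          ‖f s‖ₑ ^ 2 * ENNReal.ofReal (|s - u| ^ (2 * H - 2))) +
        ∫⁻ s in Icc 0 T, ∫⁻ u in Icc 0 T,
          ‖f u‖ₑ ^ 2 * ENNReal.ofReal (|s - u| ^ (2 * H - 2)) := by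
        rw [← lintegral_add_left (Measurable.lintegral_prod_right (by fun_prop))]
        refine lintegral_congr fun s => ?_
        rw [← lintegral_add_left (by fun_prop)]
    _ ≤ M * (∫⁻ s in Icc 0 T, ‖f s‖ₑ ^ 2) + M * ∫⁻ s in Icc 0 T, ‖f s‖ₑ ^ 2 := by
        refine add_le_add hbd (le_trans (le_of_eq ?_) hbd)
        rw [lintegral_lintegral_swap (by fun_prop)]
        refine lintegral_congr fun s => lintegral_congr fun u => ?_
        rw [abs_sub_comm]
    _ = _ := by rw [two_mul, add_mul]

/-! ### The norm of step functions for `H > 1 / 2` -/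

theorem measurable_stepFn {T : ℝ} (f : StepFn T) : Measurable (f : ℝ → ℝ) := by
  induction f using stepFn_induction with
  | hind t => exact measurable_one.indicator measurableSet_Ioc
  | hzero => exact measurable_zero
  | hadd f g hf hg => exact hf.add hg
  | hsmul a f hf => exact hf.const_smul a

theorem exists_bound_stepFn {T : ℝ} (f : StepFn T) : ∃ C, ∀ x, |(f : ℝ → ℝ) x| ≤ C := by
  induction f using stepFn_induction with
  | hind t =>
    refine ⟨1, fun x => ?_⟩
    by_cases hx : x ∈ Ioc (0 : ℝ) t <;> simp [ind, hx]
  | hzero => exact ⟨0, by simp⟩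
  | hadd f g hf hg =>
    obtain ⟨C, hC⟩ := hf
    obtain ⟨D, hD⟩ := hg
    exact ⟨C + D, fun x => (abs_add_le _ _).trans (add_le_add (hC x) (hD x))⟩
  | hsmul a f hf =>
    obtain ⟨C, hC⟩ := hf
    refine ⟨|a| * C, fun x => ?_⟩
    change |a * _| ≤ _
    rw [abs_mul]
    exact mul_le_mul_of_nonneg_left (hC x) (abs_nonneg a)

theorem integrable_stepFn_mul_kernel {a T : ℝ} (ha : -1 < a) (f g : StepFn T) :
    Integrable (fun z : ℝ × ℝ => (f : ℝ → ℝ) z.1 * (g : ℝ → ℝ) z.2 * |z.1 - z.2| ^ a)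
      ((volume.restrict (Icc 0 T)).prod (volume.restrict (Icc 0 T))) := by
  obtain ⟨C, hC⟩ := exists_bound_stepFn f
  obtain ⟨D, hD⟩ := exists_bound_stepFn g
  have hf := measurable_stepFn f
  have hg := measurable_stepFn g
  refine (integrable_abs_sub_rpow ha).bdd_mul (c := C * D)
    (Measurable.aestronglyMeasurable (by fun_prop)) (Eventually.of_forall fun z => ?_)
  rw [Real.norm_eq_abs, abs_mul]
  exact mul_le_mul (hC _) (hD _) (abs_nonneg _) ((abs_nonneg _).trans (hC z.1))

theorem setIntegral_Icc_ind_mul {T : ℝ} {t : ℝ} (ht : t ≤ T) (g : ℝ → ℝ) :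
    ∫ x in Icc 0 T, ind t x * g x = ∫ x in Ioc 0 t, g x := by
  have e : ∀ x, ind t x * g x = (Ioc 0 t).indicator g x := fun x => by
    by_cases hx : x ∈ Ioc 0 t <;> simp [ind, hx]
  simp only [e]
  rw [integral_indicator measurableSet_Ioc, Measure.restrict_restrict measurableSet_Ioc,
    inter_eq_left.2 (Ioc_subset_Icc_self.trans (Icc_subset_Icc_right ht))]

theorem integral_ind_mul_ind_mul_kernel {a T : ℝ} (ha : -1 < a) {t s : Icc (0 : ℝ) T}
    (hts : t ≤ s) :
    ∫ z : ℝ × ℝ, ind t z.1 * ind s z.2 * |z.1 - z.2| ^ a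
      ∂((volume.restrict (Icc 0 T)).prod (volume.restrict (Icc 0 T))) =
      ((t : ℝ) ^ (a + 2) + (s : ℝ) ^ (a + 2) - |(t : ℝ) - s| ^ (a + 2)) / ((a + 1) * (a + 2)) := by
  have hts' : (t : ℝ) ≤ s := hts
  rw [integral_prod _ (integrable_stepFn_mul_kernel ha ⟨_, ind_mem_stepFn t⟩ ⟨_, ind_mem_stepFn s⟩)]
  simp only [mul_assoc, integral_const_mul, setIntegral_Icc_ind_mul s.2.2]
  rw [setIntegral_Icc_ind_mul t.2.2, setIntegral_congr_fun measurableSet_Ioc fun x hx =>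
    (integral_abs_sub_rpow ha hx.1.le (hx.2.trans hts')).2,
    ← intervalIntegral.integral_of_le t.2.1]
  have h1 : -1 < a + 1 := by linarith
  have h2 : a + 1 + 1 ≠ 0 := by linarith
  have i₁ := intervalIntegral.intervalIntegrable_rpow' h1 (a := 0) (b := (t : ℝ))
  have i₂ : IntervalIntegrable (fun x => ((s : ℝ) - x) ^ (a + 1)) volume 0 t := by
    have h := (intervalIntegral.intervalIntegrable_rpow' h1 (a := (s : ℝ)) (b := s - t)).comp_sub_left
      (s : ℝ)
    rwa [sub_self, sub_sub_cancel] at h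
  rw [intervalIntegral.integral_div, intervalIntegral.integral_add i₁ i₂,
    intervalIntegral.integral_comp_sub_left (fun y => y ^ (a + 1)), integral_rpow (Or.inl h1),
    integral_rpow (Or.inl h1), Real.zero_rpow h2, abs_sub_comm, abs_of_nonneg (sub_nonneg.2 hts'),
    sub_zero, sub_zero, show a + 1 + 1 = a + 2 by ring]
  rw [← add_div, div_div, mul_comm (a + 2)]
  congr 1
  ring

section Domination

variable {Ω : Type*} [MeasurableSpace Ω] {P : Measure Ω} {T : ℝ} {B : Icc (0 : ℝ) T → Ω → ℝ} {H : ℝ}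

/-- The kernel `H(2H-1)|s-u|^(2H-2)` is the mixed second derivative of the covariance off the
diagonal; indicators are checked directly and bilinearity gives the rest. -/
theorem IsFractionalBrownianMotion.inner_stepIntegral (hH : H ∈ Ioo (1 / 2 : ℝ) 1)
    (hB : IsFractionalBrownianMotion H B P) (f g : StepFn T) :
    inner ℝ (stepIntegral hB.toIsCenteredGaussian f) (stepIntegral hB.toIsCenteredGaussian g) =
      H * (2 * H - 1) * ∫ z : ℝ × ℝ, (f : ℝ → ℝ) z.1 * (g : ℝ → ℝ) z.2 * |z.1 - z.2| ^ (2 * H - 2)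
        ∂((volume.restrict (Icc 0 T)).prod (volume.restrict (Icc 0 T))) := by
  have ha : -1 < 2 * H - 2 := by linarith [hH.1]
  have hi := integrable_stepFn_mul_kernel (T := T) ha
  induction f using stepFn_induction with
  | hind t =>
    induction g using stepFn_induction with
    | hind s =>
      rw [stepIntegral_ind, stepIntegral_ind, hB.inner_toLp]
      have h0 : H ≠ 0 := by linarith [hH.1]
      have h1 : 2 * H - 1 ≠ 0 := by linarith [hH.1]
      rcases le_total t s with h | h
      · simp only
        rw [integral_ind_mul_ind_mul_kernel ha h, show 2 * H - 2 + 1 = 2 * H - 1 by ring,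
          show 2 * H - 2 + 2 = 2 * H by ring]
        field_simp
      · rw [← integral_prod_swap]
        simp only [Prod.fst_swap, Prod.snd_swap, mul_comm (ind t _), abs_sub_comm (Prod.snd _)]
        rw [integral_ind_mul_ind_mul_kernel ha h, show 2 * H - 2 + 1 = 2 * H - 1 by ring,
          show 2 * H - 2 + 2 = 2 * H by ring, abs_sub_comm (s : ℝ)]
        field_simp
        ring
    | hzero => simp
    | hadd f g hf hg =>
      rw [map_add, inner_add_right, hf, hg, ← mul_add, ← integral_add (hi _ f) (hi _ g)]
      congr 2 with z
      simp only [Submodule.coe_add, Pi.add_apply]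
      ring
    | hsmul c f hf =>
      rw [map_smul, real_inner_smul_right, hf, mul_left_comm, ← integral_const_mul]
      congr 2 with z
      simp only [Submodule.coe_smul, Pi.smul_apply, smul_eq_mul]
      ring
  | hzero => simp
  | hadd f g hf hg =>
    rw [map_add, inner_add_left, hf, hg, ← mul_add, ← integral_add (hi f _) (hi g _)]
    congr 2 with z
    simp only [Submodule.coe_add, Pi.add_apply]
    ring
  | hsmul c f hf =>
    rw [map_smul, real_inner_smul_left, hf, mul_left_comm, ← integral_const_mul]
    congr 2 with z
    simp only [Submodule.coe_smul, Pi.smul_apply, smul_eq_mul]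
    ring

theorem IsFractionalBrownianMotion.norm_stepIntegrand_sq_le (hH : H ∈ Ioo (1 / 2 : ℝ) 1)
    (hB : IsFractionalBrownianMotion H B P) (f : StepFn T) :
    ENNReal.ofReal (‖stepIntegrand hB.toIsCenteredGaussian f‖ ^ 2) ≤
      ENNReal.ofReal (H * (2 * H - 1)) * fracNormSq H T f := by
  have hf := measurable_stepFn f
  have hc : 0 ≤ H * (2 * H - 1) := mul_nonneg (by linarith [hH.1]) (by linarith [hH.1])
  rw [norm_stepIntegrand, ← real_inner_self_eq_norm_sq, hB.inner_stepIntegral hH,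
    ENNReal.ofReal_mul hc]
  gcongr
  refine (ENNReal.ofReal_le_ofReal (le_abs_self _)).trans ?_
  rw [← Real.enorm_eq_ofReal_abs]
  refine (enorm_integral_le_lintegral_enorm _).trans (le_of_eq ?_)
  rw [lintegral_prod _ (by fun_prop), fracNormSq]
  refine lintegral_congr fun s => lintegral_congr fun u => ?_
  rw [enorm_mul, enorm_mul, Real.enorm_of_nonneg (Real.rpow_nonneg (abs_nonneg _) _)]

end Domination

/-! ### Density of step functions -/

theorem exists_stepFn_forall_sub_le {T : ℝ} (hT : 0 < T) {g : ℝ → ℝ} (hg : Continuous g) {ε : ℝ}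
    (hε : 0 < ε) : ∃ φ : StepFn T, ∀ x ∈ Ioc 0 T, |(φ : ℝ → ℝ) x - g x| ≤ ε := by
  obtain ⟨δ, hδ, hu⟩ := Metric.uniformContinuousOn_iff.1
    (isCompact_Icc.uniformContinuousOn_of_continuous (s := Icc 0 T) hg.continuousOn) ε hε
  obtain ⟨n, hn⟩ := exists_nat_gt (T / δ)
  have hn0 : (0 : ℝ) < n := (div_pos hT hδ).trans hn
  have hstep : T / n < δ := by
    rw [div_lt_iff₀ hδ] at hn
    rw [div_lt_iff₀ hn0]
    linarith
  let τ : ℕ → ℝ := fun k => k * (T / n)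
  have hτ0 : ∀ k, 0 ≤ τ k := fun k => by positivity
  have hτs : ∀ k, τ (k + 1) = τ k + T / n := fun k => by simp only [τ]; push_cast; ring
  have hτT : ∀ k ≤ n, τ k ≤ T := fun k hk => by
    calc τ k ≤ n * (T / n) := by simp only [τ]; gcongr
      _ = T := by field_simp
  have hmono : ∀ k, τ k ≤ τ (k + 1) := fun k => by rw [hτs]; linarith [div_pos hT hn0]
  -- Sample `g` at the right endpoints of a uniform partition. The indicators of the cells telescope
  -- to 1 on `(0, T]`, so the error is a weighted average of errors of size at most `ε`.
  have hmem : (∑ k ∈ Finset.range n, g (τ (k + 1)) • (ind (τ (k + 1)) - ind (τ k))) ∈ StepFn T := by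
    refine Submodule.sum_mem _ fun k hk => Submodule.smul_mem _ _ (Submodule.sub_mem _ ?_ ?_)
    · exact ind_mem_stepFn ⟨τ (k + 1), hτ0 _, hτT _ (Finset.mem_range.1 hk)⟩
    · exact ind_mem_stepFn ⟨τ k, hτ0 _, hτT _ (Finset.mem_range.1 hk).le⟩
  refine ⟨⟨_, hmem⟩, fun x hx => ?_⟩
  have hind : ∀ k, (ind (τ (k + 1)) - ind (τ k)) x = if x ∈ Ioc (τ k) (τ (k + 1)) then 1 else 0 := by
    intro k
    have hk := hmono k
    simp only [Pi.sub_apply, ind, indicator, mem_Ioc, hx.1, true_and, Pi.one_apply]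
    by_cases h1 : x ≤ τ k
    · simp [h1, h1.trans hk, not_lt.2 h1]
    · simp [h1, not_le.1 h1]
  have hsum : ∑ k ∈ Finset.range n, (ind (τ (k + 1)) - ind (τ k)) x = 1 := by
    rw [← Finset.sum_apply, Finset.sum_range_sub (fun k => ind (τ k))]
    have e0 : τ 0 = 0 := by simp [τ]
    have en : τ n = T := by simp only [τ]; field_simp
    rw [e0, en, ind_of_eq_zero rfl, sub_zero, ind, indicator_of_mem hx, Pi.one_apply]
  calc |(∑ k ∈ Finset.range n, g (τ (k + 1)) • (ind (τ (k + 1)) - ind (τ k))) x - g x|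
      = |∑ k ∈ Finset.range n, (g (τ (k + 1)) - g x) * (ind (τ (k + 1)) - ind (τ k)) x| := by
        simp only [sub_mul, Finset.sum_sub_distrib, ← Finset.mul_sum, hsum, mul_one,
          Finset.sum_apply, Pi.smul_apply, smul_eq_mul]
    _ ≤ ∑ k ∈ Finset.range n, ε * (ind (τ (k + 1)) - ind (τ k)) x := by
        refine (Finset.abs_sum_le_sum_abs _ _).trans (Finset.sum_le_sum fun k hk => ?_)
        rw [hind]
        split_ifs with h
        · rw [mul_one, mul_one]
          refine (hu (τ (k + 1)) ⟨hτ0 _, hτT _ (Finset.mem_range.1 hk)⟩ x ⟨hx.1.le, hx.2⟩ ?_).le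
          rw [Real.dist_eq, abs_of_nonneg (by linarith [h.2])]
          linarith [h.1, hτs k]
        · simp
    _ = ε := by rw [← Finset.mul_sum, hsum, mul_one]

theorem exists_stepFn_eLpNorm_sub_le {T : ℝ} (hT : 0 < T) {f : ℝ → ℝ}
    (hf : MemLp f 2 (volume.restrict (Icc 0 T))) {ε : ℝ≥0∞} (hε : ε ≠ 0) :
    ∃ φ : StepFn T, eLpNorm ((φ : ℝ → ℝ) - f) 2 (volume.restrict (Icc 0 T)) ≤ ε := by
  have hε2 : ε / 2 ≠ 0 := by simpa using hε
  obtain ⟨g, hg, hgm⟩ := hf.exists_boundedContinuous_eLpNorm_sub_le (by simp) hε2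
  set V : ℝ≥0∞ := (volume.restrict (Icc 0 T)) univ ^ (2 : ℝ≥0∞).toReal⁻¹ with hV
  have hVtop : V ≠ ∞ := by
    refine ENNReal.rpow_ne_top_of_nonneg (by positivity) ?_
    simp
  obtain ⟨δ, hδ, hVδ⟩ : ∃ δ : ℝ, 0 < δ ∧ V * ENNReal.ofReal δ ≤ ε / 2 := by
    have ht : Tendsto (fun δ : ℝ => V * ENNReal.ofReal δ) (𝓝[>] 0) (𝓝 0) := by
      have : Tendsto (fun δ : ℝ => V * ENNReal.ofReal δ) (𝓝 0) (𝓝 (V * ENNReal.ofReal 0)) :=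
        ENNReal.Tendsto.const_mul (ENNReal.continuous_ofReal.tendsto 0) (Or.inr hVtop)
      rw [ENNReal.ofReal_zero, mul_zero] at this
      exact this.mono_left nhdsWithin_le_nhds
    have := ((ht.eventually_le_const (pos_iff_ne_zero.2 hε2)).and self_mem_nhdsWithin).exists
    exact this.imp fun δ h => ⟨h.2, h.1⟩
  obtain ⟨φ, hφ⟩ := exists_stepFn_forall_sub_le hT g.continuous hδ
  refine ⟨φ, ?_⟩
  have h1 : eLpNorm ((φ : ℝ → ℝ) - ⇑g) 2 (volume.restrict (Icc 0 T)) ≤ V * ENNReal.ofReal δ := by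
    refine eLpNorm_le_of_ae_bound ?_
    rw [← restrict_Ioc_eq_restrict_Icc]
    exact ae_restrict_of_forall_mem measurableSet_Ioc hφ
  rw [← sub_add_sub_cancel (φ : ℝ → ℝ) (⇑g) f]
  refine (eLpNorm_add_le ((measurable_stepFn φ).aestronglyMeasurable.sub hgm.1)
    (hgm.1.sub hf.1) one_le_two).trans ?_
  rw [← ENNReal.add_halves ε]
  refine add_le_add (h1.trans hVδ) ?_
  rwa [eLpNorm_sub_comm]

theorem exists_stepFn_fracNormSq_le {H T : ℝ} (hH : H ∈ Ioo (1 / 2 : ℝ) 1) (hT : 0 < T) {f : ℝ → ℝ}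
    (hf : MemLp f 2 (volume.restrict (Icc 0 T))) {ε : ℝ≥0∞} (hε : ε ≠ 0) :
    ∃ φ : StepFn T, fracNormSq H T ((φ : ℝ → ℝ) - f) ≤ ε := by
  set M : ℝ≥0∞ := 2 * ENNReal.ofReal (2 * T ^ (2 * H - 2 + 1) / (2 * H - 2 + 1))
  have hM : M ≠ ∞ := ENNReal.mul_ne_top (by simp) ENNReal.ofReal_ne_top
  obtain ⟨δ, hδ, hMδ⟩ : ∃ δ : ℝ≥0∞, δ ≠ 0 ∧ M * δ ^ 2 ≤ ε := by
    have ht : Tendsto (fun δ : ℝ => M * ENNReal.ofReal δ ^ 2) (𝓝[>] 0) (𝓝 0) := by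
      have : Tendsto (fun δ : ℝ => M * ENNReal.ofReal δ ^ 2) (𝓝 0)
          (𝓝 (M * ENNReal.ofReal 0 ^ 2)) :=
        ENNReal.Tendsto.const_mul (((ENNReal.continuous_pow 2).comp ENNReal.continuous_ofReal).tendsto 0) (Or.inr hM)
      rw [ENNReal.ofReal_zero, zero_pow two_ne_zero, mul_zero] at this
      exact this.mono_left nhdsWithin_le_nhds
    obtain ⟨δ, h1, h2⟩ :=
      ((ht.eventually_le_const (pos_iff_ne_zero.2 hε)).and self_mem_nhdsWithin).exists
    exact ⟨ENNReal.ofReal δ, by simpa using h2, h1⟩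
  obtain ⟨φ, hφ⟩ := exists_stepFn_eLpNorm_sub_le hT hf hδ
  refine ⟨φ, (fracNormSq_le_lintegral_sq hH
    ((measurable_stepFn φ).aemeasurable.sub hf.1.aemeasurable)).trans (le_trans ?_ hMδ)⟩
  gcongr
  have h := eLpNorm_nnreal_pow_eq_lintegral (f := (φ : ℝ → ℝ) - f)
    (μ := volume.restrict (Icc 0 T)) (p := 2) two_ne_zero
  simp only [NNReal.coe_ofNat, ENNReal.rpow_two, ENNReal.coe_ofNat] at h
  rw [← h]
  exact pow_le_pow_left' hφ 2

/-! ### Fractional Wiener integrals -/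

section Frac

variable {Ω : Type*} [MeasurableSpace Ω] {P : Measure Ω} {T : ℝ} {B : Icc (0 : ℝ) T → Ω → ℝ} {H : ℝ}

/-- Two approximations of the same `f` merge in the space of integrands. Along `ℕ` this gives
uniqueness of the represented integrand; along `ℕ × ℕ`, with the two coordinates of one sequence, it
gives the Cauchy property. -/
theorem tendsto_norm_stepIntegrand_sub (hH : H ∈ Ioo (1 / 2 : ℝ) 1)
    (hB : IsFractionalBrownianMotion H B P) {f : ℝ → ℝ}
    (hf : AEMeasurable f (volume.restrict (Icc 0 T))) {ι : Type*} {l : Filter ι}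
    {φ ψ : ι → StepFn T} (hφ : Tendsto (fun i => fracNormSq H T ((φ i : ℝ → ℝ) - f)) l (𝓝 0))
    (hψ : Tendsto (fun i => fracNormSq H T ((ψ i : ℝ → ℝ) - f)) l (𝓝 0)) :
    Tendsto (fun i => ‖stepIntegrand hB.toIsCenteredGaussian (φ i) -
      stepIntegrand hB.toIsCenteredGaussian (ψ i)‖) l (𝓝 0) := by
  set c := ENNReal.ofReal (H * (2 * H - 1))
  have hle : ∀ i, ENNReal.ofReal (‖stepIntegrand hB.toIsCenteredGaussian (φ i) -
      stepIntegrand hB.toIsCenteredGaussian (ψ i)‖ ^ 2) ≤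
      c * (2 * (fracNormSq H T ((φ i : ℝ → ℝ) - f) + fracNormSq H T ((ψ i : ℝ → ℝ) - f))) := by
    intro i
    have h := hB.norm_stepIntegrand_sq_le hH (φ i - ψ i)
    rw [← stepIntegrandₗ_apply, map_sub] at h
    refine h.trans ?_
    gcongr
    have e : ((φ i - ψ i : StepFn T) : ℝ → ℝ) = ((φ i : ℝ → ℝ) - f) + -((ψ i : ℝ → ℝ) - f) := by
      rw [Submodule.coe_sub]
      abel
    rw [e]
    have m₁ := (measurable_stepFn (φ i)).aemeasurable.sub hf
    have m₂ := (measurable_stepFn (ψ i)).aemeasurable.sub hf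
    refine (fracNormSq_add_le hH m₁ m₂.neg).trans ?_
    rw [fracNormSq_neg]
  have hlim : Tendsto (fun i => c * (2 * (fracNormSq H T ((φ i : ℝ → ℝ) - f) +
      fracNormSq H T ((ψ i : ℝ → ℝ) - f)))) l (𝓝 0) := by
    have := ENNReal.Tendsto.const_mul (a := c) (ENNReal.Tendsto.const_mul (a := 2) (hφ.add hψ)
      (Or.inr (by simp))) (Or.inr ENNReal.ofReal_ne_top)
    simpa using this
  have h0 := tendsto_of_tendsto_of_tendsto_of_le_of_le tendsto_const_nhds hlim (fun _ => zero_le)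
    hle
  have h1 := (ENNReal.tendsto_toReal ENNReal.zero_ne_top).comp h0
  have h2 := h1.sqrt
  simp only [Function.comp_def, ENNReal.toReal_zero, Real.sqrt_zero] at h2
  refine h2.congr fun i => ?_
  rw [ENNReal.toReal_ofReal (sq_nonneg _), Real.sqrt_sq (norm_nonneg _)]

/-- `h` is the deterministic integrand which the function `f` represents. -/
def Represents (hB : IsFractionalBrownianMotion H B P) (f : ℝ → ℝ)
    (h : Integrands hB.toIsCenteredGaussian) : Prop :=
  ∃ φ : ℕ → StepFn T,
    Tendsto (fun n => fracNormSq H T ((φ n : ℝ → ℝ) - f)) atTop (𝓝 0) ∧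
    Tendsto (fun n => stepIntegrand hB.toIsCenteredGaussian (φ n)) atTop (𝓝 h)

theorem Represents.unique (hH : H ∈ Ioo (1 / 2 : ℝ) 1) {hB : IsFractionalBrownianMotion H B P}
    {f : ℝ → ℝ} (hf : AEMeasurable f (volume.restrict (Icc 0 T)))
    {h h' : Integrands hB.toIsCenteredGaussian} (H₁ : Represents hB f h)
    (H₂ : Represents hB f h') : h = h' := by
  obtain ⟨φ, hφ, hφh⟩ := H₁
  obtain ⟨ψ, hψ, hψh⟩ := H₂
  have h1 := tendsto_norm_stepIntegrand_sub hH hB hf hφ hψ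
  exact sub_eq_zero.1 (norm_eq_zero.1 (tendsto_nhds_unique (hφh.sub hψh).norm h1))

theorem exists_represents (hH : H ∈ Ioo (1 / 2 : ℝ) 1) (hT : 0 < T)
    (hB : IsFractionalBrownianMotion H B P) {f : ℝ → ℝ}
    (hf : MemLp f 2 (volume.restrict (Icc 0 T))) : ∃ h, Represents hB f h := by
  -- At `n = 0` the tolerance is `∞`, which is harmless.
  choose φ hφ using fun n : ℕ => exists_stepFn_fracNormSq_le hH hT hf
    (ε := (n : ℝ≥0∞)⁻¹) (by simp)
  have hlim : Tendsto (fun n => fracNormSq H T ((φ n : ℝ → ℝ) - f)) atTop (𝓝 0) :=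
    tendsto_of_tendsto_of_tendsto_of_le_of_le tendsto_const_nhds
      ENNReal.tendsto_inv_nat_nhds_zero (fun _ => zero_le) hφ
  have hc : CauchySeq fun n => stepIntegrand hB.toIsCenteredGaussian (φ n) := by
    rw [cauchySeq_iff_tendsto_dist_atTop_0]
    simp only [dist_eq_norm]
    rw [← prod_atTop_atTop_eq]
    exact tendsto_norm_stepIntegrand_sub hH hB hf.1.aemeasurable (φ := fun n : ℕ × ℕ => φ n.1)
      (ψ := fun n : ℕ × ℕ => φ n.2) (hlim.comp tendsto_fst) (hlim.comp tendsto_snd)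
  obtain ⟨h, hh⟩ := cauchySeq_tendsto_of_complete hc
  exact ⟨h, φ, hlim, hh⟩

/-- Truncating both `φ n` and `f` does not increase the pointwise error, and `A` is continuous and
acts on step functions as truncation. -/
theorem Represents.truncate {hB : IsFractionalBrownianMotion H B P} {f : ℝ → ℝ}
    {h : Integrands hB.toIsCenteredGaussian} (hf : Represents hB f h) {r : Icc (0 : ℝ) T}
    {A : Integrands hB.toIsCenteredGaussian →L[ℝ] Integrands hB.toIsCenteredGaussian}
    (hA : ∀ t : Icc (0 : ℝ) T, A (indIntegrand hB.toIsCenteredGaussian t) =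
      indIntegrand hB.toIsCenteredGaussian (min t r)) :
    Represents hB ((Ioc 0 (r : ℝ)).indicator f) (A h) := by
  obtain ⟨φ, hφ, hφh⟩ := hf
  refine ⟨fun n => WienerInt.truncate r (φ n), ?_, ?_⟩
  · refine tendsto_of_tendsto_of_tendsto_of_le_of_le tendsto_const_nhds hφ (fun _ => zero_le)
      fun n => fracNormSq_mono fun s => ?_
    rw [coe_truncate]
    by_cases hs : s ∈ Ioc 0 (r : ℝ) <;> simp [hs]
  · simp only [← apply_stepIntegrand_eq_truncate hB.toIsCenteredGaussian hA]
    exact (A.continuous.tendsto h).comp hφh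

theorem represents_zero (hB : IsFractionalBrownianMotion H B P) : Represents hB 0 0 := by
  refine ⟨fun _ => 0, ?_, ?_⟩
  · simp [fracNormSq]
  · simp [← stepIntegrandₗ_apply]

/-- The operator for `B` is transported to `X` through the norm-preserving map `1_{(0,t]} ↦ h t`. -/
theorem hasIndefiniteWienerIntegral_of_represents [IsProbabilityMeasure P]
    (hH : H ∈ Ioo (1 / 2 : ℝ) 1) (hB : IsFractionalBrownianMotion H B P) {σ : ℝ → ℝ}
    (hσ : AEMeasurable σ (volume.restrict (Icc 0 T)))
    {h : Icc (0 : ℝ) T → Integrands hB.toIsCenteredGaussian}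
    (hh : ∀ t : Icc (0 : ℝ) T, Represents hB ((Ioc (0 : ℝ) t).indicator σ) (h t))
    {X : Icc (0 : ℝ) T → Ω → ℝ}
    (hX : ∀ t, X t =ᵐ[P] wienerIntegral hB.toIsCenteredGaussian (h t)) :
    HasIndefiniteWienerIntegral X P := by
  have hmeas : ∀ t : Icc (0 : ℝ) T,
      AEMeasurable ((Ioc (0 : ℝ) t).indicator σ) (volume.restrict (Icc 0 T)) :=
    fun t => hσ.indicator measurableSet_Ioc
  have h0 : ∀ t : Icc (0 : ℝ) T, (t : ℝ) = 0 → h t = 0 := fun t ht => by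
    refine (hh t).unique hH (hmeas t) ?_
    rw [ht, Ioc_self, indicator_empty']
    exact represents_zero hB
  have hG : IsCenteredGaussian X P :=
    { gaussian := isGaussianProcess_wienerIntegral hB.toIsCenteredGaussian h hX
      centered := fun t => by rw [integral_congr_ae (hX t), integral_wienerIntegral]
      start := fun t ht => by
        refine (hX t).trans ?_
        rw [h0 t ht, map_zero]
        exact Lp.coeFn_zero ℝ 2 P }
  refine ⟨hG, fun r => ?_⟩
  obtain ⟨_, hA⟩ := hB.hasIndefiniteWienerIntegral ⟨by linarith [hH.1], hH.2⟩
  obtain ⟨A, hA⟩ := hA r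
  -- Both sides represent `1_{(0, t ∧ r]} σ`, so uniqueness applies.
  have hAh : ∀ t, A (h t) = h (min t r) := fun t => by
    refine Represents.unique hH (hmeas (min t r)) ?_ (hh (min t r))
    have := (hh t).truncate hA
    rwa [indicator_indicator, Ioc_inter_Ioc, max_self, min_comm] at this
  -- The indicators with `t > 0` form a basis of the step functions, so their images may be
  -- prescribed; `t = 0` is consistent because `h 0 = 0`.
  obtain ⟨S, hS⟩ : ∃ S : StepFn T →ₗ[ℝ] Integrands hB.toIsCenteredGaussian,
      ∀ t : Icc (0 : ℝ) T, S ⟨ind t, ind_mem_stepFn t⟩ = h t := by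
    refine ⟨(Finsupp.linearCombination ℝ fun t : Ioc (0 : ℝ) T =>
      h (Set.inclusion Ioc_subset_Icc_self t)) ∘ₗ (linearIndependent_indFamily T).repr, fun t => ?_⟩
    rcases t.2.1.eq_or_lt with ht | ht
    · have hz : (⟨ind t, ind_mem_stepFn t⟩ : StepFn T) = 0 := Subtype.ext (ind_of_eq_zero ht.symm)
      rw [hz, map_zero, h0 t ht.symm]
    · have hr := (linearIndependent_indFamily T).repr_eq_single ⟨t, ht, t.2.2⟩
        ⟨ind t, ind_mem_stepFn t⟩ rfl
      rw [LinearMap.comp_apply, hr, Finsupp.linearCombination_single, one_smul]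
  have hnorm : ∀ f : StepFn T, ‖stepIntegral hG f‖ = ‖S f‖ := fun f => by
    rw [← norm_wienerIntegral]
    congr 1
    refine stepFn_hom_ext
      (M := (wienerIntegral hB.toIsCenteredGaussian).toLinearMap ∘ₗ S) (fun t => ?_) f
    rw [stepIntegral_ind, LinearMap.comp_apply, hS]
    refine Lp.ext ?_
    exact (hG.memLp t).coeFn_toLp.trans (hX t)
  have hAS : ∀ f : StepFn T, S (truncate r f) = A (S f) := fun f => by
    refine stepFn_hom_ext (L := S ∘ₗ truncate r) (M := A.toLinearMap ∘ₗ S) (fun t => ?_) f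
    rw [LinearMap.comp_apply, truncate_ind, LinearMap.comp_apply, hS, hS]
    exact (hAh t).symm
  refine exists_indefinite_operator hG (C := ‖A‖) fun f => ?_
  rw [hnorm, hnorm, hAS]
  exact A.le_opNorm _

end Frac

end WienerInt

end

/-! ### The theorem -/

theorem theorem5p2 {Ω : Type*} [MeasurableSpace Ω] (P : Measure Ω) [IsProbabilityMeasure P]
    (T : ℝ) (hT : 0 < T) :
    -- (i)
    (∀ H ∈ Ioo (0 : ℝ) 1, ∀ B : Icc (0 : ℝ) T → Ω → ℝ,
      WienerInt.IsFractionalBrownianMotion H B P → WienerInt.HasIndefiniteWienerIntegral B P) ∧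
    -- (ii)
    (∀ H ∈ Ioo (1 / 2 : ℝ) 1, ∀ (B : Icc (0 : ℝ) T → Ω → ℝ)
      (hB : WienerInt.IsFractionalBrownianMotion H B P) (σ : ℝ → ℝ) (ε : ℝ),
      ε ∈ Ioo (0 : ℝ) 1 → AEMeasurable σ (volume.restrict (Icc 0 T)) →
      (∀ s ∈ Icc (0 : ℝ) T, ε ≤ σ s ∧ σ s ≤ ε⁻¹) →
      (∀ t : Icc (0 : ℝ) T, ∃ Y : Ω → ℝ,
        WienerInt.IsFractionalWienerIntegral hB ((Ioc (0 : ℝ) t).indicator σ) Y) ∧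
      ∀ X : Icc (0 : ℝ) T → Ω → ℝ,
        (∀ t : Icc (0 : ℝ) T,
          WienerInt.IsFractionalWienerIntegral hB ((Ioc (0 : ℝ) t).indicator σ) (X t)) →
        WienerInt.HasIndefiniteWienerIntegral X P) ∧
    -- (iii)
    (∀ (X₁ X₂ : Icc (0 : ℝ) T → Ω → ℝ) (γ : ℝ), γ ≠ 0 →
      IndepFun (fun ω t => X₁ t ω) (fun ω t => X₂ t ω) P →
      WienerInt.HasIndefiniteWienerIntegral X₁ P → WienerInt.HasIndefiniteWienerIntegral X₂ P →
      WienerInt.HasIndefiniteWienerIntegral (fun t ω => X₁ t ω + γ * X₂ t ω) P) := by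
  refine ⟨fun H hH B hB => hB.hasIndefiniteWienerIntegral hH, ?_,
    fun X₁ X₂ γ _ hind h₁ h₂ => h₁.add_mul_of_indepFun hind h₂⟩
  intro H hH B hB σ ε hε hσ hbd
  refine ⟨fun t => ?_, fun X hX => ?_⟩
  -- A bounded function on `[0, T]` is square integrable, which is all that `exists_represents`
  -- needs.
  · have hm : MemLp ((Ioc (0 : ℝ) t).indicator σ) 2 (volume.restrict (Icc 0 T)) := by
      refine MemLp.indicator measurableSet_Ioc (MemLp.of_bound hσ.aestronglyMeasurable ε⁻¹ ?_)
      refine ae_restrict_of_forall_mem measurableSet_Icc fun s hs => ?_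
      rw [Real.norm_eq_abs, abs_of_nonneg (hε.1.le.trans (hbd s hs).1)]
      exact (hbd s hs).2
    obtain ⟨h, hh⟩ := WienerInt.exists_represents hH hT hB hm
    exact ⟨_, h, hh, EventuallyEq.rfl⟩
  · choose h hh hXh using hX
    exact WienerInt.hasIndefiniteWienerIntegral_of_represents hH hB hσ hh hXh
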